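/- Let $\gamma>1$, $l\ge 0$, $g\in\mathbb R$ be constants and let $\mu=\mu(x_3)\ge 0$. Consider a classical ($C^1$) solution $(\rho,p,U)$, with $\rho,p\ge 0$ and $U=(U_1,U_2,U_3)$, on an open set $D\subset\mathbb R_t\times\mathbb R^3_x$, of $$\rho\bigl(\partial_t U+(U,\nabla)U+l\,e_3\times U+\mu U_H+g e_3\bigr)=-\nabla p,\qquad \partial_t\rho+\operatorname{div}(\rho U)=0,\qquad \partial_t p+(U,\nabla p)+\gamma p\operatorname{div}U=0,$$ where $e_3=(0,0,1)$ and $U_H=(U_1,U_2,0)$, and suppose that $U_3=0$ on $D$. Let $\Omega(t)\subset\mathbb R^3$, $t\in I$ ($I$ an open interval), be a material volume, that is, a family of open sets with $\{t\}\times\Omega(t)\subset D$ that consist of the same particles (integral curves of $U$) at all times. Fix a height $x_3$ and let $\Omega_H(t)\subset\mathbb R^2$ be the section of $\Omega(t)$ at this height. Assume that for all $t\in I$ the set $\Omega_H(t)$ is bounded and the points $(t,x_1,x_2,x_3)$ with $(x_1,x_2)\in\overline{\Omega_H(t)}$ lie in $D$. With $X_1=(x_1,x_2)$ and $X_2=(x_2,-x_1)$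 put $$G(t,x_3)=\tfrac12\int_{\Omega_H(t)}\rho|X_1|^2\,dx_1dx_2,\qquad F_i(t,x_3)=\int_{\Omega_H(t)}(U_H,X_i)\,\rho\,dx_1dx_2\quad(i=1,2),$$ $$E_k(t,x_3)=\tfrac12\int_{\Omega_H(t)}\rho|U_H|^2\,dx_1dx_2,\qquad E_p(t,x_3)=\tfrac1{\gamma-1}\int_{\Omega_H(t)}p\,dx_1dx_2,\qquad E=E_k+E_p.$$ Then for every $t\in I$ the function $G$ is differentiable in time at $t$ and $\partial_tG=F_1$. If moreover the pressure vanishes on the boundary of the section, i.e. $p(t,x_1,x_2,x_3)=0$ for all $(x_1,x_2)\in\partial\Omega_H(t)$, then $F_1$, $F_2$ and $E$ are also differentiable in time at $t$ and $$\partial_tF_2=lF_1-\mu F_2,\qquad \partial_tF_1=2(\gamma-1)E_p+2E_k-lF_2-\mu F_1,\qquad \partial_tE=-2\mu E_k .$$ -/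

import Mathlib

open MeasureTheory

noncomputable section

namespace RotatingGas

/-- Physical space `ℝ³`. The coordinates `x₁, x₂, x₃` have the indices `0, 1, 2`. -/
abbrev E3 : Type := EuclideanSpace ℝ (Fin 3)

/-- The horizontal plane `ℝ²`. -/
abbrev E2 : Type := EuclideanSpace ℝ (Fin 2)

/-- The upward unit vector `e₃`. -/
def e3 : E3 := !₂[0, 0, 1]

/-- The vector product of `ℝ³`. -/
def cross (v w : E3) : E3 := WithLp.toLp 2 (crossProduct v.ofLp w.ofLp)

/-- The horizontal part `U_H = (U₁, U₂, 0)` of a vector of `ℝ³`. -/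
def horizontal (v : E3) : E3 := !₂[v 0, v 1, 0]

/-- The divergence `∂₁V₁ + ∂₂V₂ + ∂₃V₃` of a vector field on `ℝ³`. -/
def divergence (V : E3 → E3) (x : E3) : ℝ :=
  ∑ i : Fin 3, fderiv ℝ V x (EuclideanSpace.single i 1) i

/-- Classical solutions, on an open set `D` of space-time, of the equations of a polytropic gas in
a frame that rotates with Coriolis parameter `l`, with gravity `g` and with dry friction on the
horizontal velocity whose coefficient `μ` depends on the height: `ρ`, `p`, `U` are continuously
differentiable on `D`, `ρ, p ≥ 0`, and the equations hold pointwise on `D`. -/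
structure IsClassicalSolution (γ l g : ℝ) (μ : ℝ → ℝ) (D : Set (ℝ × E3))
    (ρ p : ℝ → E3 → ℝ) (U : ℝ → E3 → E3) : Prop where
  isOpen : IsOpen D
  contDiffOn_density : ContDiffOn ℝ 1 (fun q : ℝ × E3 => ρ q.1 q.2) D
  contDiffOn_pressure : ContDiffOn ℝ 1 (fun q : ℝ × E3 => p q.1 q.2) D
  contDiffOn_velocity : ContDiffOn ℝ 1 (fun q : ℝ × E3 => U q.1 q.2) D
  density_nonneg : ∀ t x, (t, x) ∈ D → 0 ≤ ρ t x
  pressure_nonneg : ∀ t x, (t, x) ∈ D → 0 ≤ p t x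
  /-- `ρ (∂ₜU + (U, ∇)U + l e₃ × U + μ U_H + g e₃) = -∇p` -/
  momentum : ∀ t x, (t, x) ∈ D →
    ρ t x • (deriv (fun s => U s x) t + fderiv ℝ (U t) x (U t x)
        + l • cross e3 (U t x) + μ (x 2) • horizontal (U t x) + g • e3)
      = -gradient (p t) x
  /-- `∂ₜρ + div (ρ U) = 0` -/
  continuity : ∀ t x, (t, x) ∈ D →
    deriv (fun s => ρ s x) t + divergence (fun y => ρ t y • U t y) x = 0
  /-- `∂ₜp + (U, ∇p) + γ p div U = 0` -/
  pressure : ∀ t x, (t, x) ∈ D →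
    deriv (fun s => p s x) t + inner ℝ (U t x) (gradient (p t) x)
      + γ * p t x * divergence (U t) x = 0

/-- `Ω(t)`, `t ∈ I`, is a material volume of the velocity field `U`: it is open, and it consists of
the same particles at all times. That is, through each point that belongs to `Ω(s)` there passes
at time `s` a particle trajectory which stays in `Ω(t)` at all times `t ∈ I`. -/
structure IsMaterialVolume (I : Set ℝ) (U : ℝ → E3 → E3) (Ω : ℝ → Set E3) : Prop where
  isOpen : ∀ t ∈ I, IsOpen (Ω t)
  exists_trajectory : ∀ s ∈ I, ∀ x ∈ Ω s, ∃ c : ℝ → E3,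
    c s = x ∧ ∀ t ∈ I, c t ∈ Ω t ∧ HasDerivAt c (U t (c t)) t

/-- The point of `ℝ³` above the point `y = (x₁, x₂)` at the height `z = x₃`. -/
def atHeight (z : ℝ) (y : E2) : E3 := !₂[y 0, y 1, z]

/-- The section at the height `z`, as a subset of the plane. -/
def hsection (A : Set E3) (z : ℝ) : Set E2 := {y | atHeight z y ∈ A}

/-- `(U, X₁)` with `X₁ = (x₁, x₂)`. -/
def radialPart (v : E3) (y : E2) : ℝ := v 0 * y 0 + v 1 * y 1

/-- `(U, X₂)` with `X₂ = (x₂, -x₁)`. -/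
def angularPart (v : E3) (y : E2) : ℝ := v 0 * y 1 + v 1 * (-y 0)

/-- `G = ½ ∫ ρ |X₁|² dx₁dx₂` over the section of `Ω(t)` at the height `z`. -/
def functionalG (ρ : ℝ → E3 → ℝ) (Ω : ℝ → Set E3) (t z : ℝ) : ℝ :=
  (1 / 2) * ∫ y in hsection (Ω t) z, ρ t (atHeight z y) * ‖y‖ ^ 2

/-- `F₁ = ∫ (U, X₁) ρ dx₁dx₂`. -/
def functionalF₁ (ρ : ℝ → E3 → ℝ) (U : ℝ → E3 → E3) (Ω : ℝ → Set E3) (t z : ℝ) : ℝ :=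
  ∫ y in hsection (Ω t) z, radialPart (U t (atHeight z y)) y * ρ t (atHeight z y)

/-- `F₂ = ∫ (U, X₂) ρ dx₁dx₂`. -/
def functionalF₂ (ρ : ℝ → E3 → ℝ) (U : ℝ → E3 → E3) (Ω : ℝ → Set E3) (t z : ℝ) : ℝ :=
  ∫ y in hsection (Ω t) z, angularPart (U t (atHeight z y)) y * ρ t (atHeight z y)

/-- `E_k = ½ ∫ ρ |U_H|² dx₁dx₂`. -/
def kineticEnergy (ρ : ℝ → E3 → ℝ) (U : ℝ → E3 → E3) (Ω : ℝ → Set E3) (t z : ℝ) : ℝ :=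
  (1 / 2) * ∫ y in hsection (Ω t) z,
    ρ t (atHeight z y) * ‖horizontal (U t (atHeight z y))‖ ^ 2

/-- `E_p = 1/(γ - 1) ∫ p dx₁dx₂`. -/
def potentialEnergy (γ : ℝ) (p : ℝ → E3 → ℝ) (Ω : ℝ → Set E3) (t z : ℝ) : ℝ :=
  (1 / (γ - 1)) * ∫ y in hsection (Ω t) z, p t (atHeight z y)

/-- `E = E_k + E_p`. -/
def totalEnergy (γ : ℝ) (ρ p : ℝ → E3 → ℝ) (U : ℝ → E3 → E3) (Ω : ℝ → Set E3) (t z : ℝ) : ℝ :=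
  kineticEnergy ρ U Ω t z + potentialEnergy γ p Ω t z

end RotatingGas

end

/-! Since `U₃ = 0`, particles keep their height, and vertical derivatives drop out of the transport
terms and of the divergence. On each horizontal plane the density, the pressure and `U_H` therefore
satisfy a closed planar gas system, and the section is a material set for it
(`IsClassicalSolution.isPlanarSolution`, `IsMaterialVolume.isPlanarMaterial`).

Two tools give all the rates. Reynolds transport (`hasDerivAt_setIntegral_of_trajectories`) together
with conservation of mass yields d/dt ∫ ρ a = ∫ ρ Da, where D is the derivative along particles.
Integration by parts (`setIntegral_fderiv_mul_eq_zero`) yields ∫ div (p W) = 0 when `p` vanishes on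
the boundary. The choice a = |X₁|² / 2 gives `G`; the choices a = (U, W) with W = X₁, X₂, U_H and
the momentum equation give `F₁`, `F₂`, `E_k`. In the total energy the work ∫ p div U cancels between
`E_k` and `E_p`.

The difficulty is regularity: a section is an arbitrary bounded open set, and trajectories are given
only one by one. Over short times the flow map is injective and Lipschitz, hence differentiable
almost everywhere, and `exists_forall_norm_remainder_sub_le` makes its Jacobian 1 + h div v + o(h)
uniformly, which suffices for a change of variables. The boundary is handled by replacing `p` with
`flatten ε p`, which is quadratically small near zeros of `p`: its product with a `C¹` function,
extended by zero, is differentiable everywhere, and then ε → 0. -/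

open MeasureTheory

noncomputable section

namespace RotatingGas

open Set Metric Filter Topology

/-! ### Short-time estimates for trajectories of a `C¹` field -/

section Trajectories

variable {E : Type*} [NormedAddCommGroup E] [NormedSpace ℝ E]

/-- `c` is an integral curve of the time-dependent field `v` on `[t₀ - r, t₀ + r]`. -/
def IsTrajectory (v : ℝ × E → E) (t₀ r : ℝ) (c : ℝ → E) : Prop :=
  ∀ s ∈ closedBall t₀ r, HasDerivAt c (v (s, c s)) s

theorem IsTrajectory.mono {v : ℝ × E → E} {t₀ r r' : ℝ} {c : ℝ → E}
    (h : IsTrajectory v t₀ r c) (hr : r' ≤ r) : IsTrajectory v t₀ r' c :=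
  fun s hs => h s (closedBall_subset_closedBall hr hs)

theorem norm_sub_le_of_hasDerivAt_closedBall {w w' : ℝ → E} {t₀ r C : ℝ}
    (hw : ∀ s ∈ closedBall t₀ r, HasDerivAt w (w' s) s)
    (hC : ∀ s ∈ closedBall t₀ r, ‖w' s‖ ≤ C) {s : ℝ} (hs : s ∈ closedBall t₀ r) :
    ‖w s - w t₀‖ ≤ C * |s - t₀| := by
  have ht : t₀ ∈ closedBall t₀ r := mem_closedBall_self (dist_nonneg.trans hs)
  simpa [Real.norm_eq_abs] using
    (convex_closedBall t₀ r).norm_image_sub_le_of_norm_hasDerivWithin_le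
      (fun x hx => (hw x hx).hasDerivWithinAt) hC ht hs

/-- A substitute for Grönwall: at a time where the distance is maximal, the mean value inequality
bounds this maximum by the initial distance plus `r * L ≤ 1 / 2` times the maximum itself. -/
theorem IsTrajectory.norm_sub_le_two_mul {v : ℝ × E → E} {L : NNReal} (hL : LipschitzWith L v)
    {t₀ r : ℝ} (hr : r * L ≤ 1 / 2) {c c' : ℝ → E} (hc : IsTrajectory v t₀ r c)
    (hc' : IsTrajectory v t₀ r c') {s : ℝ} (hs : s ∈ closedBall t₀ r) :
    ‖c s - c' s‖ ≤ 2 * ‖c t₀ - c' t₀‖ := by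
  have hd : ∀ s ∈ closedBall t₀ r,
      HasDerivAt (fun s => c s - c' s) (v (s, c s) - v (s, c' s)) s :=
    fun s hs => (hc s hs).sub (hc' s hs)
  obtain ⟨m, hm, hmax⟩ := (isCompact_closedBall t₀ r).exists_isMaxOn ⟨s, hs⟩
    (f := fun s => ‖c s - c' s‖)
    (fun s hs => (hd s hs).continuousAt.norm.continuousWithinAt)
  have hlip : ∀ s ∈ closedBall t₀ r, ‖v (s, c s) - v (s, c' s)‖ ≤ L * ‖c m - c' m‖ := by
    intro s hs
    refine (hL.norm_sub_le _ _).trans ?_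
    have : ‖(s, c s) - (s, c' s)‖ = ‖c s - c' s‖ := by simp [Prod.norm_def]
    rw [this]
    exact mul_le_mul_of_nonneg_left (hmax hs) L.2
  have h1 := norm_sub_le_of_hasDerivAt_closedBall hd hlip hm
  have h2 : ‖c m - c' m‖ ≤ ‖c t₀ - c' t₀‖ + ‖(c m - c' m) - (c t₀ - c' t₀)‖ := by
    have := norm_add_le (c t₀ - c' t₀) ((c m - c' m) - (c t₀ - c' t₀))
    simpa using this
  have h3 : |m - t₀| ≤ r := by simpa [Real.dist_eq] using hm
  have h4 : (L : ℝ) * ‖c m - c' m‖ * |m - t₀| ≤ 1 / 2 * ‖c m - c' m‖ := by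
    calc (L : ℝ) * ‖c m - c' m‖ * |m - t₀| ≤ (L : ℝ) * ‖c m - c' m‖ * r := by gcongr
      _ = r * L * ‖c m - c' m‖ := by ring
      _ ≤ _ := by gcongr
  have h5 : ‖c s - c' s‖ ≤ ‖c m - c' m‖ := hmax hs
  linarith

/-- The factor `|s - t₀|` makes the displacement a contraction in the starting point for short
times, whence the injectivity of the flow map. -/
theorem IsTrajectory.norm_displacement_sub_le {v : ℝ × E → E} {L : NNReal}
    (hL : LipschitzWith L v) {t₀ r : ℝ} (hr : r * L ≤ 1 / 2) {c c' : ℝ → E}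
    (hc : IsTrajectory v t₀ r c) (hc' : IsTrajectory v t₀ r c') {s : ℝ}
    (hs : s ∈ closedBall t₀ r) :
    ‖(c s - c t₀) - (c' s - c' t₀)‖ ≤ 2 * L * |s - t₀| * ‖c t₀ - c' t₀‖ := by
  have h1 := norm_sub_le_of_hasDerivAt_closedBall (w := fun s => c s - c' s)
    (C := L * (2 * ‖c t₀ - c' t₀‖)) (fun s hs => (hc s hs).sub (hc' s hs)) (fun s hs => by
      refine (hL.norm_sub_le _ _).trans ?_
      have : ‖(s, c s) - (s, c' s)‖ = ‖c s - c' s‖ := by simp [Prod.norm_def]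
      rw [this]
      exact mul_le_mul_of_nonneg_left (hc.norm_sub_le_two_mul hL hr hc' hs) L.2) hs
  calc _ = ‖c s - c' s - (c t₀ - c' t₀)‖ := by congr 1; abel
    _ ≤ _ := h1
    _ = _ := by ring

theorem IsTrajectory.norm_sub_le {v : ℝ × E → E} {M : ℝ} (hM : ∀ q, ‖v q‖ ≤ M)
    {t₀ r : ℝ} {c : ℝ → E} (hc : IsTrajectory v t₀ r c) {s : ℝ} (hs : s ∈ closedBall t₀ r) :
    ‖c s - c t₀‖ ≤ M * |s - t₀| :=
  norm_sub_le_of_hasDerivAt_closedBall hc (fun _ _ => hM _) hs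

theorem IsTrajectory.norm_spacetime_sub_le {v : ℝ × E → E} {M : ℝ} (hM : ∀ q, ‖v q‖ ≤ M)
    {t₀ r : ℝ} {c : ℝ → E} (hc : IsTrajectory v t₀ r c) {s : ℝ} (hs : s ∈ closedBall t₀ r) :
    ‖(s, c s) - (t₀, c t₀)‖ ≤ (M + 1) * |s - t₀| := by
  have hM0 : 0 ≤ M := (norm_nonneg _).trans (hM (t₀, c t₀))
  have := hc.norm_sub_le hM hs
  rw [Prod.mk_sub_mk, Prod.norm_def, Real.norm_eq_abs]
  have h0 := abs_nonneg (s - t₀)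
  exact max_le (by nlinarith) (by dsimp; nlinarith)

theorem exists_forall_norm_fderiv_sub_le {X F : Type*} [NormedAddCommGroup X] [NormedSpace ℝ X]
    [NormedAddCommGroup F] [NormedSpace ℝ F] {f : X → F} (hf : ContDiff ℝ 1 f)
    (hfs : HasCompactSupport f) {ε : ℝ} (hε : 0 < ε) :
    ∃ δ > 0, ∀ x y, ‖x - y‖ < δ → ‖fderiv ℝ f x - fderiv ℝ f y‖ ≤ ε := by
  have hu := (hfs.fderiv (𝕜 := ℝ)).uniformContinuous_of_continuous
    (hf.continuous_fderiv one_ne_zero)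
  obtain ⟨δ, hδ, h⟩ := Metric.uniformContinuous_iff.mp hu ε hε
  refine ⟨δ, hδ, fun x y hxy => ?_⟩
  have := h (a := x) (b := y) (by rwa [dist_eq_norm])
  rw [dist_eq_norm] at this
  exact this.le

/-- To first order in time the flow of a `C¹` field is the displacement by the field, with an
error whose Lipschitz constant in space is of lower order. -/
theorem exists_forall_norm_remainder_sub_le {v : ℝ × E → E} (hv : ContDiff ℝ 1 v)
    (hvs : HasCompactSupport v) (t₀ : ℝ) {ε : ℝ} (hε : 0 < ε) :
    ∃ τ > 0, ∀ r ≤ τ, ∀ c c' : ℝ → E, IsTrajectory v t₀ r c → IsTrajectory v t₀ r c' →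
      ∀ s ∈ closedBall t₀ r,
      ‖(c s - c t₀ - (s - t₀) • v (t₀, c t₀)) - (c' s - c' t₀ - (s - t₀) • v (t₀, c' t₀))‖
        ≤ ε * |s - t₀| * ‖c t₀ - c' t₀‖ := by
  obtain ⟨L, hL⟩ := hv.lipschitzWith_of_hasCompactSupport hvs (by simp)
  obtain ⟨M, hM⟩ := hvs.exists_bound_of_continuous hv.continuous
  have hM0 : 0 ≤ M := (norm_nonneg _).trans (hM (t₀, 0))
  obtain ⟨δ, hδ, hδv⟩ := exists_forall_norm_fderiv_sub_le hv hvs (half_pos hε)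
  -- The three bounds ensure, in turn, `r * L ≤ 1 / 2`, that trajectories move by less than `δ` in
  -- space-time, and that `2 * L ^ 2 * r ≤ ε / 2`.
  set τ := min (1 / (2 * (L + 1 : ℝ))) (min (δ / (2 * (M + 1))) (ε / (4 * (L + 1 : ℝ) ^ 2)))
  have hL0 : (0 : ℝ) ≤ L := L.2
  have hτ : 0 < τ := by positivity
  refine ⟨τ, hτ, fun r hr c c' hc hc' s hs => ?_⟩
  have hr1 : r * L ≤ 1 / 2 := by
    have : r * (2 * (L + 1 : ℝ)) ≤ 1 := (le_div_iff₀ (by positivity)).mp (hr.trans (min_le_left _ _))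
    have hr0 : 0 ≤ r := dist_nonneg.trans hs
    nlinarith
  have hr2 : r * (2 * (M + 1)) ≤ δ := (le_div_iff₀ (by positivity)).mp
    (hr.trans ((min_le_right _ _).trans (min_le_left _ _)))
  have hr3 : r * (4 * (L + 1 : ℝ) ^ 2) ≤ ε := (le_div_iff₀ (by positivity)).mp
    (hr.trans ((min_le_right _ _).trans (min_le_right _ _)))
  have key : ∀ σ ∈ closedBall t₀ r,
      ‖(v (σ, c σ) - v (t₀, c t₀)) - (v (σ, c' σ) - v (t₀, c' t₀))‖ ≤ ε * ‖c t₀ - c' t₀‖ := by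
    intro σ hσ
    have hσr : |σ - t₀| ≤ r := by simpa [Real.dist_eq] using hσ
    -- Both initial points are shifted by the same vector `k`. The map `q ↦ v (q + k) - v q` has a
    -- small derivative by uniform continuity of `fderiv ℝ v`, so no second derivative of `v` is
    -- needed; what remains is the difference of the two displacements.
    set k : ℝ × E := (σ, c' σ) - (t₀, c' t₀)
    have hk : ‖k‖ < δ := by
      have h1 := hc'.norm_spacetime_sub_le hM hσ
      have h2 : (M + 1) * |σ - t₀| ≤ (M + 1) * r := by gcongr
      have : (M + 1) * r ≤ δ / 2 := by linarith
      exact (h1.trans (h2.trans this)).trans_lt (half_lt_self hδ)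
    have hdiff : Differentiable ℝ v := hv.differentiable one_ne_zero
    have hG : ∀ q : ℝ × E, HasFDerivAt (fun q => v (q + k) - v q)
        (fderiv ℝ v (q + k) - fderiv ℝ v q) q := fun q =>
      (((hasFDerivAt_comp_add_right k).2 (hdiff (q + k)).hasFDerivAt)).sub (hdiff q).hasFDerivAt
    have h1 := (convex_univ (𝕜 := ℝ) (E := ℝ × E)).norm_image_sub_le_of_norm_hasFDerivWithin_le
      (C := ε / 2)
      (fun q _ => (hG q).hasFDerivWithinAt) (fun q _ => hδv _ _ (by simpa using hk))
      (mem_univ (t₀, c' t₀)) (mem_univ (t₀, c t₀))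
    have h2 : ‖v (σ, c σ) - v ((t₀, c t₀) + k)‖ ≤ ε / 2 * ‖c t₀ - c' t₀‖ := by
      refine (hL.norm_sub_le _ _).trans ?_
      have h3 : ‖(σ, c σ) - ((t₀, c t₀) + k)‖ = ‖(c σ - c t₀) - (c' σ - c' t₀)‖ := by
        have : (σ, c σ) - ((t₀, c t₀) + k) = (0, (c σ - c t₀) - (c' σ - c' t₀)) := by
          ext <;> simp [k]
          abel
        rw [this]
        simp [Prod.norm_def]
      rw [h3]
      have h4 := hc.norm_displacement_sub_le hL hr1 hc' hσ
      have h5 : (L : ℝ) * (2 * L * |σ - t₀|) ≤ ε / 2 := by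
        calc (L : ℝ) * (2 * L * |σ - t₀|) ≤ (L + 1 : ℝ) * (2 * (L + 1) * r) := by
              gcongr <;> linarith
          _ ≤ ε / 2 := by linarith
      calc (L : ℝ) * ‖(c σ - c t₀) - (c' σ - c' t₀)‖
          ≤ L * (2 * L * |σ - t₀| * ‖c t₀ - c' t₀‖) := by gcongr
        _ = L * (2 * L * |σ - t₀|) * ‖c t₀ - c' t₀‖ := by ring
        _ ≤ _ := by gcongr
    have h6 : ‖(t₀, c t₀) - (t₀, c' t₀)‖ = ‖c t₀ - c' t₀‖ := by simp [Prod.norm_def]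
    have h7 : (t₀, c' t₀) + k = (σ, c' σ) := by simp [k]
    rw [h6, h7] at h1
    calc _ = ‖(v (σ, c σ) - v ((t₀, c t₀) + k))
          + (v ((t₀, c t₀) + k) - v (t₀, c t₀) - (v (σ, c' σ) - v (t₀, c' t₀)))‖ := by
            congr 1; abel
      _ ≤ ε / 2 * ‖c t₀ - c' t₀‖ + ε / 2 * ‖c t₀ - c' t₀‖ := norm_add_le_of_le h2 h1
      _ = _ := by ring
  have hlin : ∀ (x : E) (σ : ℝ), HasDerivAt (fun σ : ℝ => (σ - t₀) • x) x σ := fun x σ => by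
    simpa using ((hasDerivAt_id σ).sub_const t₀).smul_const x
  have := norm_sub_le_of_hasDerivAt_closedBall
    (w := fun σ => (c σ - (σ - t₀) • v (t₀, c t₀)) - (c' σ - (σ - t₀) • v (t₀, c' t₀)))
    (fun σ hσ => ((hc σ hσ).sub (hlin _ σ)).sub ((hc' σ hσ).sub (hlin _ σ))) key hs
  calc _ = _ := by congr 1; simp only [sub_self, zero_smul, sub_zero]; abel
    _ ≤ _ := this
    _ = _ := by ring

/-- First order expansion in time of a `C¹` function along trajectories. -/
theorem exists_forall_norm_comp_trajectory_sub_le {F : Type*} [NormedAddCommGroup F]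
    [NormedSpace ℝ F] {v : ℝ × E → E} (hv : ContDiff ℝ 1 v)
    (hvs : HasCompactSupport v) {f : ℝ × E → F} (hf : ContDiff ℝ 1 f)
    (hfs : HasCompactSupport f) (t₀ : ℝ) {ε : ℝ} (hε : 0 < ε) :
    ∃ τ > 0, ∀ r ≤ τ, ∀ c : ℝ → E, IsTrajectory v t₀ r c → ∀ s ∈ closedBall t₀ r,
      ‖f (s, c s) - f (t₀, c t₀) - (s - t₀) • fderiv ℝ f (t₀, c t₀) (1, v (t₀, c t₀))‖
        ≤ ε * |s - t₀| := by
  obtain ⟨M, hM⟩ := hvs.exists_bound_of_continuous hv.continuous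
  have hM0 : 0 ≤ M := (norm_nonneg _).trans (hM (t₀, 0))
  set g : ℝ × E → F := fun q => fderiv ℝ f q (1, v q)
  have hg : Continuous g :=
    (hf.continuous_fderiv one_ne_zero).clm_apply (continuous_const.prodMk hv.continuous)
  have hgs : HasCompactSupport g := (hfs.fderiv (𝕜 := ℝ)).mono' (by
    intro q hq
    apply subset_tsupport
    intro h
    exact hq (by simp [g, h]))
  obtain ⟨δ, hδ, hgu⟩ := Metric.uniformContinuous_iff.mp
    (hgs.uniformContinuous_of_continuous hg) ε hε
  refine ⟨δ / (2 * (M + 1)), by positivity, fun r hr c hc s hs => ?_⟩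
  have hr2 : r * (2 * (M + 1)) ≤ δ := (le_div_iff₀ (by positivity)).mp hr
  have hderiv : ∀ σ ∈ closedBall t₀ r, HasDerivAt
      (fun σ => f (σ, c σ) - (σ - t₀) • g (t₀, c t₀)) (g (σ, c σ) - g (t₀, c t₀)) σ := by
    intro σ hσ
    have h1 : HasDerivAt (fun σ => f (σ, c σ)) (g (σ, c σ)) σ :=
      ((hf.differentiable one_ne_zero) (σ, c σ)).hasFDerivAt.comp_hasDerivAt σ
        ((hasDerivAt_id σ).prodMk (hc σ hσ))
    refine h1.sub ?_
    simpa using ((hasDerivAt_id σ).sub_const t₀).smul_const (g (t₀, c t₀))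
  have := norm_sub_le_of_hasDerivAt_closedBall hderiv (C := ε) (fun σ hσ => by
    have hσr : |σ - t₀| ≤ r := by simpa [Real.dist_eq] using hσ
    have h1 := hc.norm_spacetime_sub_le hM hσ
    have h2 : (M + 1) * |σ - t₀| ≤ (M + 1) * r := by gcongr
    have h3 : (M + 1) * r ≤ δ / 2 := by linarith
    have := hgu (a := (σ, c σ)) (b := (t₀, c t₀)) (by
      rw [dist_eq_norm]
      exact (h1.trans (h2.trans h3)).trans_lt (half_lt_self hδ))
    rw [dist_eq_norm] at this
    exact this.le) hs
  calc _ = _ := by congr 1; simp only [sub_self, zero_smul, sub_zero, g]; abel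
    _ ≤ _ := this

end Trajectories

/-! ### Change of variables for Lipschitz maps -/

section ChangeOfVariables

/-- Haar measure and the Hausdorff measure of full dimension have the same null sets, and a
Lipschitz map enlarges the latter at most by a constant factor. -/
theorem volume_image_eq_zero_of_lipschitzOnWith {E : Type*} [NormedAddCommGroup E]
    [NormedSpace ℝ E] [FiniteDimensional ℝ E] [MeasurableSpace E] [BorelSpace E]
    (μ : Measure E) [μ.IsAddHaarMeasure] {C : NNReal} {f : E → E} {s : Set E}
    (hf : LipschitzOnWith C f s) (hs : μ s = 0) : μ (f '' s) = 0 := by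
  have h1 : Measure.hausdorffMeasure (Module.finrank ℝ E : ℝ) s = 0 :=
    Measure.absolutelyContinuous_isAddHaarMeasure _ μ hs
  refine Measure.absolutelyContinuous_isAddHaarMeasure μ
    (Measure.hausdorffMeasure (Module.finrank ℝ E : ℝ)) ?_
  refine le_antisymm ?_ (zero_le)
  refine (hf.hausdorffMeasure_image_le (Nat.cast_nonneg _)).trans ?_
  rw [h1, mul_zero]

/-- Change of variables for an injective Lipschitz map, which is differentiable only almost
everywhere. -/
theorem setIntegral_image_of_lipschitzOnWith {E F : Type*} [NormedAddCommGroup E]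
    [NormedSpace ℝ E] [FiniteDimensional ℝ E] [MeasurableSpace E] [BorelSpace E]
    [NormedAddCommGroup F] [NormedSpace ℝ F]
    (μ : Measure E) [μ.IsAddHaarMeasure] {C : NNReal} {f : E → E} {s : Set E} (hs : IsOpen s)
    (hf : LipschitzOnWith C f s) (hinj : InjOn f s) {g : E → F} (hg : IntegrableOn g (f '' s) μ) :
    (∀ᵐ x ∂μ, x ∈ s → DifferentiableAt ℝ f x) ∧
    IntegrableOn (fun x => |(fderiv ℝ f x).det| • g (f x)) s μ ∧
    ∫ x in f '' s, g x ∂μ = ∫ x in s, |(fderiv ℝ f x).det| • g (f x) ∂μ := by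
  have hae : ∀ᵐ x ∂μ, x ∈ s → DifferentiableAt ℝ f x := by
    filter_upwards [hf.ae_differentiableWithinAt_of_mem (μ := μ)] with x hx hxs
    exact (hx hxs).differentiableAt (hs.mem_nhds hxs)
  -- By Rademacher `s \ t` is null, and so is its image since `f` is Lipschitz; the classical
  -- formula on `t` therefore suffices.
  set t := s ∩ {x | DifferentiableAt ℝ f x}
  have hts : t ⊆ s := inter_subset_left
  have ht : MeasurableSet t := hs.measurableSet.inter (measurableSet_of_differentiableAt ℝ f)
  have hst : μ (s \ t) = 0 := by
    refine measure_mono_null ?_ (ae_iff.mp hae)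
    rintro x ⟨hx, hxt⟩ h
    exact hxt ⟨hx, h hx⟩
  have hst' : (t : Set E) =ᵐ[μ] s :=
    hts.eventuallyLE.antisymm (ae_le_set.mpr hst)
  have hft : (f '' t : Set E) =ᵐ[μ] f '' s := by
    refine (image_mono hts).eventuallyLE.antisymm (ae_le_set.mpr ?_)
    refine measure_mono_null ?_
      (volume_image_eq_zero_of_lipschitzOnWith μ (hf.mono (sdiff_subset (t := t))) hst)
    rintro _ ⟨⟨x, hx, rfl⟩, hxt⟩
    exact ⟨x, ⟨hx, fun h => hxt ⟨x, h, rfl⟩⟩, rfl⟩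
  have hder : ∀ x ∈ t, HasFDerivWithinAt f (fderiv ℝ f x) t x :=
    fun x hx => hx.2.hasFDerivAt.hasFDerivWithinAt
  have hinjt := hinj.mono hts
  refine ⟨hae, ?_, ?_⟩
  · rw [← integrableOn_congr_set_ae hst',
      ← integrableOn_image_iff_integrableOn_abs_det_fderiv_smul μ ht hder hinjt]
    exact hg.mono_set (image_mono hts)
  · rw [← setIntegral_congr_set hft, ← setIntegral_congr_set hst',
      integral_image_eq_integral_abs_det_fderiv_smul μ ht hder hinjt]

end ChangeOfVariables

/-! ### First order expansion of planar determinants -/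

section PlaneDeterminant

/-- The trace of an endomorphism of the plane. -/
def planeTrace (A : E2 →L[ℝ] E2) : ℝ :=
  A (EuclideanSpace.single 0 1) 0 + A (EuclideanSpace.single 1 1) 1

/-- The divergence of a planar vector field. -/
def planeDiv (V : E2 → E2) (y : E2) : ℝ := planeTrace (fderiv ℝ V y)

theorem planeTrace_sub (A B : E2 →L[ℝ] E2) : planeTrace (A - B) = planeTrace A - planeTrace B := by
  simp [planeTrace]; ring

theorem planeTrace_smul (c : ℝ) (A : E2 →L[ℝ] E2) : planeTrace (c • A) = c * planeTrace A := by
  simp [planeTrace]; ring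

theorem abs_apply_single_le (A : E2 →L[ℝ] E2) (i j : Fin 2) :
    |A (EuclideanSpace.single i 1) j| ≤ ‖A‖ := by
  rw [← Real.norm_eq_abs]
  refine (PiLp.norm_apply_le _ j).trans ((A.le_opNorm _).trans ?_)
  simp

theorem abs_planeTrace_le (A : E2 →L[ℝ] E2) : |planeTrace A| ≤ 2 * ‖A‖ := by
  have := abs_add_le (A (EuclideanSpace.single 0 1) 0) (A (EuclideanSpace.single 1 1) 1)
  have h0 := abs_apply_single_le A 0 0
  have h1 := abs_apply_single_le A 1 1
  unfold planeTrace
  linarith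

theorem plane_det_eq (A : E2 →L[ℝ] E2) :
    A.det = A (EuclideanSpace.single 0 1) 0 * A (EuclideanSpace.single 1 1) 1
      - A (EuclideanSpace.single 1 1) 0 * A (EuclideanSpace.single 0 1) 1 := by
  rw [ContinuousLinearMap.det, ← LinearMap.det_toMatrix (EuclideanSpace.basisFun (Fin 2) ℝ).toBasis,
    Matrix.det_fin_two]
  simp [LinearMap.toMatrix_apply]

/-- In the plane det (1 + B) = 1 + tr B + det B exactly, and det B is a difference of two products
of entries bounded by `‖B‖`. -/
theorem abs_det_sub_one_sub_planeTrace_le (A : E2 →L[ℝ] E2) :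
    |A.det - 1 - planeTrace (A - ContinuousLinearMap.id ℝ E2)|
      ≤ 2 * ‖A - ContinuousLinearMap.id ℝ E2‖ ^ 2 := by
  set B := A - ContinuousLinearMap.id ℝ E2
  have hA : ∀ x, A x = B x + x := fun x => by simp [B]
  have h : A.det - 1 - planeTrace B = B (EuclideanSpace.single 0 1) 0 * B (EuclideanSpace.single 1 1) 1
      - B (EuclideanSpace.single 1 1) 0 * B (EuclideanSpace.single 0 1) 1 := by
    rw [plane_det_eq, planeTrace]
    simp only [hA]
    simp
    ring
  rw [h]
  have h00 := abs_apply_single_le B 0 0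
  have h11 := abs_apply_single_le B 1 1
  have h01 := abs_apply_single_le B 0 1
  have h10 := abs_apply_single_le B 1 0
  refine (abs_sub _ _).trans ?_
  rw [abs_mul, abs_mul, pow_two, two_mul]
  gcongr

/-- First order expansion of the Jacobian determinant. -/
theorem abs_abs_det_sub_le {C η h : ℝ} {A D : E2 →L[ℝ] E2} (hA : ‖A‖ ≤ C)
    (hη : η ≤ 1) (hD : ‖D - ContinuousLinearMap.id ℝ E2 - h • A‖ ≤ η * |h|)
    (hh : 2 * C * |h| ≤ 1) :
    |(|D.det| - 1 - h * planeTrace A)| ≤ (2 * η + 2 * (C + 1) ^ 2 * |h|) * |h| := by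
  have hC : 0 ≤ C := (norm_nonneg _).trans hA
  have h0 := abs_nonneg h
  set B := D - ContinuousLinearMap.id ℝ E2
  have hB : ‖B‖ ≤ (C + 1) * |h| := by
    have h1 : ‖B‖ ≤ ‖B - h • A‖ + ‖h • A‖ := by
      simpa using norm_add_le (B - h • A) (h • A)
    have h2 : ‖h • A‖ ≤ |h| * C := by
      rw [norm_smul, Real.norm_eq_abs]
      gcongr
    nlinarith
  have h1 := abs_det_sub_one_sub_planeTrace_le D
  have h2 : |planeTrace B - h * planeTrace A| ≤ 2 * (η * |h|) := by
    rw [← planeTrace_smul, ← planeTrace_sub]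
    exact (abs_planeTrace_le _).trans (by gcongr)
  -- This gives `0 ≤ 1 + h * planeTrace A`, so taking the absolute value of the determinant does not
  -- increase the error.
  have h3 : |h * planeTrace A| ≤ 1 := by
    rw [abs_mul]
    have := abs_planeTrace_le A
    calc |h| * |planeTrace A| ≤ |h| * (2 * C) := by gcongr; linarith
      _ ≤ 1 := by linarith
  have h4 : |(|D.det| - |1 + h * planeTrace A|)| ≤ |D.det - (1 + h * planeTrace A)| :=
    abs_abs_sub_abs_le_abs_sub _ _
  rw [abs_of_nonneg (by linarith [(abs_le.mp h3).1] : 0 ≤ 1 + h * planeTrace A)] at h4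
  have h5 : D.det - (1 + h * planeTrace A)
      = (D.det - 1 - planeTrace B) + (planeTrace B - h * planeTrace A) := by ring
  have h6 : ‖B‖ ^ 2 ≤ ((C + 1) * |h|) ^ 2 := by gcongr
  calc |(|D.det| - 1 - h * planeTrace A)| = |(|D.det| - (1 + h * planeTrace A))| := by
        congr 1; ring
    _ ≤ |D.det - (1 + h * planeTrace A)| := h4
    _ ≤ |D.det - 1 - planeTrace B| + |planeTrace B - h * planeTrace A| := by
        rw [h5]; exact abs_add_le _ _
    _ ≤ 2 * ((C + 1) * |h|) ^ 2 + 2 * (η * |h|) := by linarith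
    _ = _ := by ring

/-- The product rule for first order expansions with explicit error, meant for `a` the integrand at
the moved particle and `d` the Jacobian. The quadratic term `h * h * (a₁ * d₁)` is absorbed by `|h|
≤ δ`. -/
theorem abs_mul_sub_sub_le {a a₀ a₁ d d₁ C δ h : ℝ} (hδ0 : 0 ≤ δ) (hδ1 : δ ≤ 1)
    (ha : |a - a₀ - h * a₁| ≤ δ * |h|) (hd : |d - 1 - h * d₁| ≤ δ * |h|)
    (ha₀ : |a₀| ≤ C) (ha₁ : |a₁| ≤ C) (hd₁ : |d₁| ≤ C) (hh : |h| ≤ δ) :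
    |d * a - a₀ - h * (a₁ + a₀ * d₁)| ≤ δ * (2 + 3 * C + C ^ 2) * |h| := by
  have hC : 0 ≤ C := (abs_nonneg _).trans ha₀
  have h0 := abs_nonneg h
  have h1 : |h| ≤ 1 := hh.trans hδ1
  have hd' : |d| ≤ 2 + C := by
    have e : d = (d - 1 - h * d₁) + (1 + h * d₁) := by ring
    have h2 : |h * d₁| ≤ C := by
      rw [abs_mul]; nlinarith [abs_nonneg d₁]
    have h3 : |1 + h * d₁| ≤ 1 + C := (abs_add_le _ _).trans (by simpa using h2)
    rw [e]
    refine (abs_add_le _ _).trans ?_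
    nlinarith
  have ha' : |a₀ + h * a₁| ≤ 2 * C := by
    refine (abs_add_le _ _).trans ?_
    rw [abs_mul]; nlinarith [abs_nonneg a₁]
  have e : d * a - a₀ - h * (a₁ + a₀ * d₁) =
      (a - a₀ - h * a₁) * d + (a₀ + h * a₁) * (d - 1 - h * d₁) + h * h * (a₁ * d₁) := by ring
  rw [e]
  refine (abs_add_three _ _ _).trans ?_
  have e1 : |(a - a₀ - h * a₁) * d| ≤ (δ * |h|) * (2 + C) := by
    rw [abs_mul]; gcongr
  have e2 : |(a₀ + h * a₁) * (d - 1 - h * d₁)| ≤ (2 * C) * (δ * |h|) := by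
    rw [abs_mul]; gcongr
  have e3 : |h * h * (a₁ * d₁)| ≤ |h| * δ * (C * C) := by
    rw [abs_mul, abs_mul, abs_mul]; gcongr
  linarith

end PlaneDeterminant

/-! ### Reynolds transport with compact support -/

/-- **Reynolds transport theorem** for a field and a density on the whole plane with compact
support in space-time. -/
theorem hasDerivAt_setIntegral_of_hasCompactSupport {v : ℝ × E2 → E2} {f : ℝ × E2 → ℝ}
    (hv : ContDiff ℝ 1 v) (hvs : HasCompactSupport v) (hf : ContDiff ℝ 1 f)
    (hfs : HasCompactSupport f) {ω : ℝ → Set E2} {t₀ τ₀ : ℝ} (hτ₀ : 0 < τ₀)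
    (hopen : IsOpen (ω t₀)) (hbdd : Bornology.IsBounded (ω t₀)) {φ : E2 → ℝ → E2}
    (hφ₀ : ∀ y ∈ ω t₀, φ y t₀ = y) (hφ : ∀ y ∈ ω t₀, IsTrajectory v t₀ τ₀ (φ y))
    (hφω : ∀ s ∈ closedBall t₀ τ₀, (fun y => φ y s) '' ω t₀ = ω s) :
    HasDerivAt (fun s => ∫ y in ω s, f (s, y))
      (∫ y in ω t₀, (fderiv ℝ f (t₀, y) (1, v (t₀, y))
        + f (t₀, y) * planeDiv (fun y => v (t₀, y)) y)) t₀ := by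
  obtain ⟨L, hL⟩ := hv.lipschitzWith_of_hasCompactSupport hvs (by simp)
  obtain ⟨Mv, hMv⟩ := hvs.exists_bound_of_continuous hv.continuous
  obtain ⟨Mf, hMf⟩ := hfs.exists_bound_of_continuous hf.continuous
  obtain ⟨Mf', hMf'⟩ := (hfs.fderiv (𝕜 := ℝ)).exists_bound_of_continuous
    (hf.continuous_fderiv one_ne_zero)
  have hMv0 : 0 ≤ Mv := (norm_nonneg _).trans (hMv (t₀, 0))
  have hMf0 : 0 ≤ Mf := (norm_nonneg _).trans (hMf (t₀, 0))
  have hMf'0 : 0 ≤ Mf' := (norm_nonneg _).trans (hMf' (t₀, 0))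
  have hL0 : (0 : ℝ) ≤ L := L.2
  set A : E2 → E2 →L[ℝ] E2 := fun y => fderiv ℝ (fun y => v (t₀, y)) y
  have hAn : ∀ y, ‖A y‖ ≤ L := fun y => by
    refine norm_fderiv_le_of_lipschitz ℝ (f := fun y => v (t₀, y)) ?_
    exact LipschitzWith.of_dist_le_mul fun a b => by
      simpa [Prod.dist_eq] using hL.dist_le_mul (t₀, a) (t₀, b)
  have hAd : ∀ y, HasFDerivAt (fun y => v (t₀, y)) (A y) y := fun y => by
    refine DifferentiableAt.hasFDerivAt ?_
    exact ((hv.comp (contDiff_const.prodMk contDiff_id)).differentiable one_ne_zero) y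
  -- A common bound for `f`, for its derivative along `v`, and for the divergence of `v`, which is
  -- at most `2 * L`.
  set C : ℝ := Mf + Mf' * (Mv + 1) + 2 * L with hCdef
  have hC0 : 0 ≤ C := by positivity
  have hCf : Mf ≤ C := by
    have : 0 ≤ Mf' * (Mv + 1) := by positivity
    linarith
  have hCf' : Mf' * (Mv + 1) ≤ C := by linarith
  have hLC : 2 * L ≤ C := by
    have : 0 ≤ Mf' * (Mv + 1) := by positivity
    linarith
  clear_value C
  set g : E2 → ℝ := fun y => fderiv ℝ f (t₀, y) (1, v (t₀, y))
    + f (t₀, y) * planeDiv (fun y => v (t₀, y)) y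
  have hvol : volume (ω t₀) < ⊤ := hbdd.measure_lt_top
  have hAcont : Continuous A :=
    (hv.comp (contDiff_const.prodMk contDiff_id)).continuous_fderiv one_ne_zero
  have hgcont : Continuous g := by
    have h1 : Continuous (fun y : E2 => (t₀, y)) := by fun_prop
    have h2 : Continuous (fun y => planeDiv (fun y => v (t₀, y)) y) := by
      have : ∀ i : Fin 2, Continuous fun y => A y (EuclideanSpace.single i 1) :=
        fun i => hAcont.clm_apply continuous_const
      exact ((EuclideanSpace.proj 0 : E2 →L[ℝ] ℝ).continuous.comp (this 0)).add
        ((EuclideanSpace.proj 1 : E2 →L[ℝ] ℝ).continuous.comp (this 1))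
    exact (((hf.continuous_fderiv one_ne_zero).comp h1).clm_apply
      (continuous_const.prodMk (hv.continuous.comp h1))).add ((hf.continuous.comp h1).mul h2)
  have hfint : ∀ s, Continuous (fun y => f (s, y)) := fun s =>
    hf.continuous.comp (by fun_prop)
  have hintOn : ∀ k : E2 → ℝ, Continuous k → IntegrableOn k (ω t₀) := fun k hk =>
    (hk.continuousOn.integrableOn_compact hbdd.isCompact_closure).mono_set subset_closure
  rw [hasDerivAt_iff_isLittleO, Asymptotics.isLittleO_iff]
  intro ε hε
  set V := volume.real (ω t₀)
  have hV0 : 0 ≤ V := measureReal_nonneg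
  -- Chosen so that the pointwise error of `abs_mul_sub_sub_le`, integrated over `ω t₀`, is at most
  -- `ε * |h|`; `V + 1` avoids division by zero.
  set δ : ℝ := min (1 / 2) (ε / ((V + 1) * (2 + 3 * C + C ^ 2)))
  have hδ : 0 < δ := by positivity
  have hδ1 : δ ≤ 1 := (min_le_left _ _).trans (by norm_num)
  have hδ2 : δ / 4 ≤ 1 := by linarith
  have hδε : δ * (2 + 3 * C + C ^ 2) * V ≤ ε := by
    have h1 : δ * ((V + 1) * (2 + 3 * C + C ^ 2)) ≤ ε :=
      (le_div_iff₀ (by positivity)).mp (min_le_right _ _)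
    have h2 : 0 ≤ δ * (2 + 3 * C + C ^ 2) := by positivity
    linarith
  clear_value δ
  obtain ⟨τ₁, hτ₁, h₁⟩ := exists_forall_norm_remainder_sub_le hv hvs t₀ (ε := δ / 4) (by positivity)
  obtain ⟨τ₂, hτ₂, h₂⟩ := exists_forall_norm_comp_trajectory_sub_le hv hvs hf hfs t₀ hδ
  -- The bound `δ / (4 * (C + 1) ^ 2)` limits the quadratic error of the Jacobian to `δ / 2`, the
  -- other half being twice the `δ / 4` above. The last bound gives `r * L ≤ 1 / 2` and `2 * C * |h|
  -- ≤ 1`.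
  set r : ℝ := min (min τ₀ (min τ₁ τ₂)) (min δ (min (δ / (4 * (C + 1) ^ 2)) (1 / (4 * (C + 1)))))
  have hr : 0 < r := by positivity
  have hrτ₀ : r ≤ τ₀ := (min_le_left _ _).trans (min_le_left _ _)
  have hrτ₁ : r ≤ τ₁ := (min_le_left _ _).trans ((min_le_right _ _).trans (min_le_left _ _))
  have hrτ₂ : r ≤ τ₂ := (min_le_left _ _).trans ((min_le_right _ _).trans (min_le_right _ _))
  have hrδ : r ≤ δ := (min_le_right _ _).trans (min_le_left _ _)
  have hrδ' : r ≤ δ / (4 * (C + 1) ^ 2) :=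
    (min_le_right _ _).trans ((min_le_right _ _).trans (min_le_left _ _))
  have hrC : r ≤ 1 / (4 * (C + 1)) :=
    (min_le_right _ _).trans ((min_le_right _ _).trans (min_le_right _ _))
  have hrC' : r * (4 * (C + 1)) ≤ 1 := (le_div_iff₀ (by positivity)).mp hrC
  have hrδ2 : r * (4 * (C + 1) ^ 2) ≤ δ := (le_div_iff₀ (by positivity)).mp hrδ'
  clear_value r
  have hLC' : (L : ℝ) ≤ C := by linarith
  have hrL : r * L ≤ 1 / 2 := by nlinarith
  filter_upwards [closedBall_mem_nhds t₀ hr] with s hs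
  set h := s - t₀ with hh
  have hhr : |h| ≤ r := by simpa [Real.dist_eq] using hs
  have hh0 := abs_nonneg h
  set Φ : E2 → E2 := fun y => φ y s
  have htr : ∀ y ∈ ω t₀, IsTrajectory v t₀ r (φ y) := fun y hy => (hφ y hy).mono hrτ₀
  have hlip : LipschitzOnWith 2 Φ (ω t₀) := LipschitzOnWith.of_dist_le_mul fun y hy y' hy' => by
    have := (htr y hy).norm_sub_le_two_mul hL hrL (htr y' hy') hs
    rw [hφ₀ y hy, hφ₀ y' hy'] at this
    simpa [dist_eq_norm] using this
  -- If two particles meet at time `s`, their displacements differ by exactly their initial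
  -- separation, yet by at most half of it.
  have hinj : InjOn Φ (ω t₀) := by
    intro y hy y' hy' heq
    have h1 := (htr y hy).norm_displacement_sub_le hL hrL (htr y' hy') hs
    rw [hφ₀ y hy, hφ₀ y' hy', show φ y s = φ y' s from heq] at h1
    have h2 : ‖φ y' s - y - (φ y' s - y')‖ = ‖y - y'‖ := by
      rw [← norm_neg]; congr 1; abel
    rw [h2] at h1
    have h3 : 2 * L * |h| ≤ 1 / 2 := by nlinarith
    have h4 : ‖y - y'‖ ≤ 1 / 2 * ‖y - y'‖ := h1.trans (by gcongr)
    have h5 : ‖y - y'‖ = 0 := le_antisymm (by linarith) (norm_nonneg _)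
    exact sub_eq_zero.mp (norm_eq_zero.mp h5)
  have himg : Φ '' ω t₀ = ω s := hφω s (closedBall_subset_closedBall hrτ₀ hs)
  have hcs : IntegrableOn (fun y => f (s, y)) (Φ '' ω t₀) := by
    have h1 : Bornology.IsBounded (Φ '' ω t₀) := by
      obtain ⟨R, hR⟩ := isBounded_iff.mp hbdd
      refine isBounded_iff.mpr ⟨2 * R, ?_⟩
      rintro _ ⟨y, hy, rfl⟩ _ ⟨y', hy', rfl⟩
      exact (hlip.dist_le_mul y hy y' hy').trans
        (mul_le_mul_of_nonneg_left (hR hy hy') (by norm_num))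
    exact ((hfint s).continuousOn.integrableOn_compact h1.isCompact_closure).mono_set subset_closure
  obtain ⟨hdiff, hint, hchange⟩ := setIntegral_image_of_lipschitzOnWith volume hopen hlip hinj hcs
  have hest : ∀ᵐ y, y ∈ ω t₀ → ‖|(fderiv ℝ Φ y).det| • f (s, Φ y) - f (t₀, y) - h * g y‖
      ≤ δ * (2 + 3 * C + C ^ 2) * |h| := by
    filter_upwards [hdiff] with y hy hyω
    have hD : HasFDerivAt (fun y' => Φ y' - y' - h • v (t₀, y'))
        (fderiv ℝ Φ y - ContinuousLinearMap.id ℝ E2 - h • A y) y :=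
      ((hy hyω).hasFDerivAt.sub (hasFDerivAt_id y)).sub ((hAd y).const_smul h)
    -- The remainder of the flow map is Lipschitz near `y` with this constant, which bounds its
    -- derivative wherever that exists.
    have hDn : ‖fderiv ℝ Φ y - ContinuousLinearMap.id ℝ E2 - h • A y‖ ≤ δ / 4 * |h| := by
      refine hD.le_of_lip' (by positivity) ?_
      filter_upwards [hopen.mem_nhds hyω] with y' hy'
      have := h₁ r hrτ₁ _ _ (htr y' hy') (htr y hyω) s hs
      simpa only [hφ₀ y hyω, hφ₀ y' hy'] using this
    have hdet := abs_abs_det_sub_le ((hAn y).trans hLC') hδ2 hDn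
      (by nlinarith)
    have hdet' : (2 * (δ / 4) + 2 * (C + 1) ^ 2 * |h|) * |h| ≤ δ * |h| := by
      have : (C + 1) ^ 2 * |h| ≤ (C + 1) ^ 2 * r := by gcongr
      gcongr
      linarith
    have hfe := h₂ r hrτ₂ _ (htr y hyω) s hs
    rw [hφ₀ y hyω] at hfe
    have hb0 : |f (t₀, y)| ≤ C := by
      have := hMf (t₀, y)
      rw [Real.norm_eq_abs] at this
      exact this.trans hCf
    have hb1 : |fderiv ℝ f (t₀, y) (1, v (t₀, y))| ≤ C := by
      rw [← Real.norm_eq_abs]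
      refine (ContinuousLinearMap.le_opNorm _ _).trans ?_
      have h1 : ‖((1 : ℝ), v (t₀, y))‖ ≤ Mv + 1 := by
        rw [Prod.norm_def]
        refine max_le (by simpa using hMv0) ((hMv _).trans (by linarith))
      have h2 : ‖fderiv ℝ f (t₀, y)‖ * ‖((1 : ℝ), v (t₀, y))‖ ≤ Mf' * (Mv + 1) := by
        gcongr
        exact hMf' _
      linarith
    have hb2 : |planeTrace (A y)| ≤ C := (abs_planeTrace_le _).trans (by linarith [hAn y])
    exact abs_mul_sub_sub_le hδ.le hδ1 hfe (hdet.trans hdet') hb0 hb1 hb2 (hhr.trans hrδ)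
  have hI0 := hintOn _ (hfint t₀)
  have hIg := hintOn _ hgcont
  have heq : (∫ y in ω s, f (s, y)) - (∫ y in ω t₀, f (t₀, y)) - h • (∫ y in ω t₀, g y)
      = ∫ y in ω t₀, (|(fderiv ℝ Φ y).det| • f (s, Φ y) - f (t₀, y) - h * g y) := by
    have e1 := integral_sub (hint.sub hI0) (hIg.const_mul h)
    have e2 := integral_sub hint hI0
    rw [integral_const_mul] at e1
    simp only [Pi.sub_apply] at e1
    rw [e1, e2, ← himg, hchange, smul_eq_mul]
  rw [heq]
  refine (norm_setIntegral_le_of_norm_le_const_ae' hvol hest).trans ?_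
  rw [Real.norm_eq_abs]
  calc δ * (2 + 3 * C + C ^ 2) * |h| * V = δ * (2 + 3 * C + C ^ 2) * V * |h| := by ring
    _ ≤ ε * |h| := by gcongr

/-! ### Reynolds transport on an open domain, by cutting off -/

section Localization

theorem contDiff_smul_of_tsupport_subset {X F : Type*} [NormedAddCommGroup X] [NormedSpace ℝ X]
    [NormedAddCommGroup F] [NormedSpace ℝ F] {D : Set X} (hD : IsOpen D) {χ : X → ℝ}
    (hχ : ContDiff ℝ 1 χ) (hχD : tsupport χ ⊆ D) {f : X → F} (hf : ContDiffOn ℝ 1 f D) :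
    ContDiff ℝ 1 (fun x => χ x • f x) :=
  contDiff_iff_contDiffAt.mpr fun x => by
    by_cases hx : x ∈ tsupport χ
    · exact hχ.contDiffAt.smul (hf.contDiffAt (hD.mem_nhds (hχD hx)))
    · refine (contDiffAt_const (c := (0 : F))).congr_of_eventuallyEq ?_
      filter_upwards [(isClosed_tsupport χ).isOpen_compl.mem_nhds hx] with y hy
      rw [image_eq_zero_of_notMem_tsupport hy, zero_smul]

theorem exists_contDiff_one_near_of_isCompact {X : Type*} [NormedAddCommGroup X]
    [NormedSpace ℝ X] [FiniteDimensional ℝ X] {K D : Set X} (hK : IsCompact K) (hD : IsOpen D)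
    (hKD : K ⊆ D) : ∃ (χ : X → ℝ) (r : ℝ), 0 < r ∧ ContDiff ℝ 1 χ ∧ HasCompactSupport χ ∧
      tsupport χ ⊆ D ∧ ∀ x ∈ thickening r K, χ x = 1 := by
  have : ProperSpace X := FiniteDimensional.proper ℝ X
  obtain ⟨K', hK', hKK', hK'D⟩ := exists_compact_between hK hD hKD
  obtain ⟨χ, hχ1, hχ0, -⟩ := exists_contMDiffMap_one_nhds_of_subset_interior
    (modelWithCornersSelf ℝ X) (n := 1) hK.isClosed hKK'
  have hsupp : tsupport χ ⊆ K' := closure_minimal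
    (fun x hx => by_contra fun h => hx (hχ0 x h)) hK'.isClosed
  obtain ⟨W, hW, hKW, hWχ⟩ := eventually_nhdsSet_iff_exists.mp hχ1
  obtain ⟨r, hr, hrW⟩ := hK.exists_thickening_subset_open hW hKW
  exact ⟨χ, r, hr, contMDiff_iff_contDiff.mp χ.contMDiff,
    hK'.of_isClosed_subset (isClosed_tsupport _) hsupp, hsupp.trans hK'D,
    fun x hx => hWχ x (hrW hx)⟩

/-- A trajectory cannot move faster than a bound for the field in the region that it can reach at
this speed. -/
theorem IsTrajectory.norm_sub_le_of_bound_near {E : Type*} [NormedAddCommGroup E]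
    [NormedSpace ℝ E] {v : ℝ × E → E} {t₀ τ M : ℝ} {c : ℝ → E} (hc : IsTrajectory v t₀ τ c)
    (hM : ∀ s ∈ closedBall t₀ τ, ∀ y, ‖y - c t₀‖ ≤ M * |s - t₀| → ‖v (s, y)‖ < M) {s : ℝ}
    (hs : s ∈ closedBall t₀ τ) : ‖c s - c t₀‖ ≤ M * |s - t₀| := by
  -- The sign `σ` treats both directions of time by a forward barrier argument: whenever the
  -- distance equals the barrier `M * x`, its speed is strictly below `M`.
  have key : ∀ σ : ℝ, |σ| = 1 → ∀ x ∈ Icc 0 τ, ‖c (t₀ + σ * x) - c t₀‖ ≤ M * x := by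
    intro σ hσ
    have hmem : ∀ x ∈ Icc 0 τ, t₀ + σ * x ∈ closedBall t₀ τ := fun x hx => by
      simpa [Real.dist_eq, abs_mul, hσ, abs_of_nonneg hx.1] using hx.2
    have hd : ∀ x ∈ Icc 0 τ, HasDerivAt (fun x => c (t₀ + σ * x) - c t₀)
        (σ • v (t₀ + σ * x, c (t₀ + σ * x))) x := fun x hx => by
      have h1 : HasDerivAt (fun x : ℝ => t₀ + σ * x) σ x := by
        simpa using ((hasDerivAt_id x).const_mul σ).const_add t₀
      exact (HasDerivAt.scomp x (hc _ (hmem x hx)) h1).sub_const _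
    refine image_norm_le_of_norm_deriv_right_lt_deriv_boundary (B := fun x => M * x)
      (B' := fun _ => M) (fun x hx => (hd x hx).continuousAt.continuousWithinAt)
      (fun x hx => (hd x (Ico_subset_Icc_self hx)).hasDerivWithinAt) (by simp)
      (fun x => by simpa using (hasDerivAt_id x).const_mul M) ?_
    intro x hx heq
    have hx' := Ico_subset_Icc_self hx
    rw [norm_smul, Real.norm_eq_abs, hσ, one_mul]
    refine hM _ (hmem x hx') _ (heq.le.trans ?_)
    simp [abs_mul, hσ, abs_of_nonneg hx'.1]
  have hsτ : |s - t₀| ≤ τ := by simpa [Real.dist_eq] using hs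
  rcases le_total t₀ s with h | h
  · have := key 1 (by simp) (|s - t₀|) ⟨abs_nonneg _, hsτ⟩
    rw [abs_of_nonneg (sub_nonneg.mpr h)] at this ⊢
    simpa using this
  · have := key (-1) (by simp) (|s - t₀|) ⟨abs_nonneg _, hsτ⟩
    rw [abs_of_nonpos (sub_nonpos.mpr h)] at this ⊢
    simpa using this

/-- **Reynolds transport theorem**: the time derivative of the integral of a `C¹` function over a
set that is transported by a planar `C¹` velocity field. -/
theorem hasDerivAt_setIntegral_of_trajectories {D : Set (ℝ × E2)} (hD : IsOpen D)
    {v : ℝ × E2 → E2} {f : ℝ × E2 → ℝ} (hv : ContDiffOn ℝ 1 v D) (hf : ContDiffOn ℝ 1 f D)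
    {I : Set ℝ} (hI : IsOpen I) {ω : ℝ → Set E2} (hopen : ∀ s ∈ I, IsOpen (ω s))
    (htraj : ∀ s ∈ I, ∀ y ∈ ω s, ∃ c : ℝ → E2,
      c s = y ∧ ∀ t ∈ I, c t ∈ ω t ∧ HasDerivAt c (v (t, c t)) t)
    {t₀ : ℝ} (ht₀ : t₀ ∈ I) (hbdd : Bornology.IsBounded (ω t₀))
    (hclos : ∀ y ∈ closure (ω t₀), (t₀, y) ∈ D) :
    HasDerivAt (fun s => ∫ y in ω s, f (s, y))
      (∫ y in ω t₀, (fderiv ℝ f (t₀, y) (1, v (t₀, y))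
        + f (t₀, y) * planeDiv (fun y => v (t₀, y)) y)) t₀ := by
  set K : Set (ℝ × E2) := {t₀} ×ˢ closure (ω t₀)
  have hK : IsCompact K := isCompact_singleton.prod hbdd.isCompact_closure
  have hKD : K ⊆ D := by
    rintro ⟨s, y⟩ ⟨hs, hy⟩
    obtain rfl : s = t₀ := hs
    exact hclos y hy
  obtain ⟨χ, r, hr, hχ, hχs, hχD, hχ1⟩ := exists_contDiff_one_near_of_isCompact hK hD hKD
  set v' : ℝ × E2 → E2 := fun q => χ q • v q with hv'def
  set f' : ℝ × E2 → ℝ := fun q => χ q • f q with hf'def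
  have hv' : ContDiff ℝ 1 v' := contDiff_smul_of_tsupport_subset hD hχ hχD hv
  have hf' : ContDiff ℝ 1 f' := contDiff_smul_of_tsupport_subset hD hχ hχD hf
  have hv's : HasCompactSupport v' := hχs.smul_right
  have hf's : HasCompactSupport f' := hχs.smul_right
  have hvv' : ∀ q ∈ thickening r K, v' q = v q := fun q hq => by simp [hv'def, hχ1 q hq]
  have hff' : ∀ q ∈ thickening r K, f' q = f q := fun q hq => by simp [hf'def, hχ1 q hq]
  obtain ⟨L, hL⟩ := hv'.lipschitzWith_of_hasCompactSupport hv's (by simp)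
  obtain ⟨M, hM⟩ := hv's.exists_bound_of_continuous hv'.continuous
  have hM0 : 0 ≤ M := (norm_nonneg _).trans (hM (t₀, 0))
  have hL0 : (0 : ℝ) ≤ L := L.2
  obtain ⟨τ₁, hτ₁, hτ₁I⟩ := nhds_basis_closedBall.mem_iff.mp (hI.mem_nhds ht₀)
  -- Short enough to stay in `I`, to separate trajectories, and to move by at most `r / 2` in time
  -- and in space.
  set τ : ℝ := min τ₁ (min (1 / (2 * (L + 1 : ℝ))) (min (r / 2) (r / (2 * (M + 1)))))
  have hτ : 0 < τ := by positivity
  have hττ₁ : τ ≤ τ₁ := min_le_left _ _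
  have hτL : τ * L ≤ 1 / 2 := by
    have : τ * (2 * (L + 1 : ℝ)) ≤ 1 := (le_div_iff₀ (by positivity)).mp
      ((min_le_right _ _).trans (min_le_left _ _))
    nlinarith
  have hτr : τ ≤ r / 2 :=
    (min_le_right _ _).trans ((min_le_right _ _).trans (min_le_left _ _))
  have hτM : τ * (2 * (M + 1)) ≤ r := (le_div_iff₀ (by positivity)).mp
    ((min_le_right _ _).trans ((min_le_right _ _).trans (min_le_right _ _)))
  clear_value τ
  have hτI : closedBall t₀ τ ⊆ I := (closedBall_subset_closedBall hττ₁).trans hτ₁I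
  have hnear : ∀ x ∈ ω t₀, ∀ s ∈ closedBall t₀ τ, ∀ y, ‖y - x‖ ≤ (M + 1) * |s - t₀| →
      (s, y) ∈ thickening r K := by
    intro x hx s hs y hy
    have hs' : |s - t₀| ≤ τ := by simpa [Real.dist_eq] using hs
    refine mem_thickening_iff.mpr ⟨(t₀, x), ⟨rfl, subset_closure hx⟩, ?_⟩
    rw [Prod.dist_eq, max_lt_iff]
    constructor
    · change dist s t₀ < r
      rw [Real.dist_eq]
      linarith
    · change dist y x < r
      rw [dist_eq_norm]
      have : (M + 1) * |s - t₀| ≤ (M + 1) * τ := by gcongr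
      linarith
  -- A trajectory cannot leave the region where the cutoff is 1, so it is also one of the truncated
  -- field. The speed bound is `M + 1` because the barrier argument needs strict inequality.
  have hlocal : ∀ c : ℝ → E2, c t₀ ∈ ω t₀ → IsTrajectory v t₀ τ c →
      IsTrajectory v' t₀ τ c ∧ ∀ s ∈ closedBall t₀ τ, (s, c s) ∈ thickening r K := by
    intro c hc0 hc
    have hb : ∀ s ∈ closedBall t₀ τ, (s, c s) ∈ thickening r K := fun s hs =>
      hnear _ hc0 s hs _ (hc.norm_sub_le_of_bound_near (fun s hs y hy => by
        rw [← hvv' _ (hnear _ hc0 s hs y hy)]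
        exact (hM _).trans_lt (lt_add_one M)) hs)
    exact ⟨fun s hs => by rw [hvv' _ (hb s hs)]; exact hc s hs, hb⟩
  choose! φ hφ₀ hφ using htraj t₀ ht₀
  have hφt : ∀ y ∈ ω t₀, IsTrajectory v t₀ τ (φ y) := fun y hy s hs => (hφ y hy s (hτI hs)).2
  have hφω : ∀ s ∈ closedBall t₀ τ, (fun y => φ y s) '' ω t₀ = ω s := by
    intro s hs
    refine Subset.antisymm ?_ fun x hx => ?_
    · rintro _ ⟨y, hy, rfl⟩
      exact (hφ y hy s (hτI hs)).1
    -- Surjectivity: the particle at `x` is followed back to time `t₀`, and uniqueness of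
    -- trajectories identifies it with the chosen `φ (c t₀)`.
    · obtain ⟨c, hcs, hc⟩ := htraj s (hτI hs) x hx
      have hc0 := (hc t₀ ht₀).1
      refine ⟨c t₀, hc0, ?_⟩
      have h1 := (hlocal c hc0 fun s hs => (hc s (hτI hs)).2).1
      have h2 := (hlocal (φ (c t₀)) (by rwa [hφ₀ _ hc0]) (hφt _ hc0)).1
      have h3 := h2.norm_sub_le_two_mul hL hτL h1 hs
      rw [hφ₀ _ hc0, sub_self, norm_zero, mul_zero] at h3
      exact (sub_eq_zero.mp (norm_le_zero_iff.mp h3)).trans hcs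
  have hmain := hasDerivAt_setIntegral_of_hasCompactSupport hv' hv's hf' hf's hτ (hopen t₀ ht₀)
    hbdd hφ₀ (fun y hy => (hlocal _ (by rwa [hφ₀ y hy]) (hφt y hy)).1) hφω
  have hωnear : ∀ s ∈ closedBall t₀ τ, ∀ y ∈ ω s, (s, y) ∈ thickening r K := by
    intro s hs y hy
    rw [← hφω s hs] at hy
    obtain ⟨x, hx, rfl⟩ := hy
    exact (hlocal _ (by rwa [hφ₀ x hx]) (hφt x hx)).2 s hs
  have hint : ∫ y in ω t₀, (fderiv ℝ f' (t₀, y) (1, v' (t₀, y))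
        + f' (t₀, y) * planeDiv (fun y => v' (t₀, y)) y)
      = ∫ y in ω t₀, (fderiv ℝ f (t₀, y) (1, v (t₀, y))
        + f (t₀, y) * planeDiv (fun y => v (t₀, y)) y) := by
    refine setIntegral_congr_fun (hopen t₀ ht₀).measurableSet fun y hy => ?_
    have hmem := hωnear t₀ (mem_closedBall_self hτ.le) y hy
    have hnhds := isOpen_thickening.mem_nhds hmem
    have e1 : fderiv ℝ f' (t₀, y) = fderiv ℝ f (t₀, y) :=
      Filter.EventuallyEq.fderiv_eq (by filter_upwards [hnhds] with q hq using hff' q hq)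
    have e2 : planeDiv (fun y => v' (t₀, y)) y = planeDiv (fun y => v (t₀, y)) y := by
      unfold planeDiv
      congr 1
      refine Filter.EventuallyEq.fderiv_eq ?_
      have hcont : ContinuousAt (fun y : E2 => (t₀, y)) y := by fun_prop
      filter_upwards [hcont.preimage_mem_nhds hnhds] with y' hy' using hvv' _ hy'
    simp only [e1, e2, hvv' _ hmem, hff' _ hmem]
  rw [hint] at hmain
  refine hmain.congr_of_eventuallyEq ?_
  filter_upwards [closedBall_mem_nhds t₀ hτ] with s hs
  exact setIntegral_congr_fun (hopen s (hτI hs)).measurableSet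
    fun y hy => (hff' _ (hωnear s hs y hy)).symm

end Localization

/-! ### Integration by parts without boundary regularity -/

section DivergenceTheorem

variable {E : Type*} [NormedAddCommGroup E] [NormedSpace ℝ E]

/-- A smooth function of `s ≥ 0` which vanishes to second order at `0` and approximates `s`. -/
def flatten (ε s : ℝ) : ℝ := s - ε + ε ^ 2 / (s + ε)

theorem flatten_eq {ε s : ℝ} (h : s + ε ≠ 0) : flatten ε s = s ^ 2 / (s + ε) := by
  unfold flatten; field_simp; ring

theorem hasDerivAt_flatten {ε s : ℝ} (h : s + ε ≠ 0) :
    HasDerivAt (flatten ε) (1 - ε ^ 2 / (s + ε) ^ 2) s := by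
  have h1 : HasDerivAt (fun s => s + ε) 1 s := (hasDerivAt_id s).add_const ε
  have h2 := ((hasDerivAt_id s).sub_const ε).add ((h1.inv h).const_mul (ε ^ 2))
  refine (h2.congr_deriv (by ring)).congr_of_eventuallyEq ?_
  exact Eventually.of_forall fun x => by simp [flatten, div_eq_mul_inv]

/-- Only frontier points matter: there `p` vanishes and is differentiable, so p = O(|z - y|), and
`flatten ε p ≤ p ^ 2 / ε` is O(|z - y|²). The extension by zero thus has derivative zero, whatever
the shape of `ω`. -/
theorem hasFDerivAt_flatten_mul_indicator {ω V : Set E} (hω : IsOpen ω) (hV : IsOpen V)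
    (hωV : closure ω ⊆ V) {p w : E → ℝ} (hp : ContDiffOn ℝ 1 p V) (hw : ContDiffOn ℝ 1 w V)
    (hp0 : ∀ y ∈ V, 0 ≤ p y) (hfr : ∀ y ∈ frontier ω, p y = 0) {ε : ℝ} (hε : 0 < ε) (y : E) :
    HasFDerivAt (ω.indicator fun y => flatten ε (p y) * w y)
      (ω.indicator (fun y => flatten ε (p y) • fderiv ℝ w y
        + w y • (1 - ε ^ 2 / (p y + ε) ^ 2) • fderiv ℝ p y) y) y := by
  by_cases hy : y ∈ ω
  · have hyV := hωV (subset_closure hy)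
    have hpy := ((hp.contDiffAt (hV.mem_nhds hyV)).differentiableAt one_ne_zero).hasFDerivAt
    have hwy := ((hw.contDiffAt (hV.mem_nhds hyV)).differentiableAt one_ne_zero).hasFDerivAt
    have hne : p y + ε ≠ 0 := (add_pos_of_nonneg_of_pos (hp0 y hyV) hε).ne'
    rw [indicator_of_mem hy]
    refine (((hasDerivAt_flatten hne).comp_hasFDerivAt y hpy).mul hwy).congr_of_eventuallyEq ?_
    filter_upwards [hω.mem_nhds hy] with z hz
    rw [indicator_of_mem hz]
    rfl
  · rw [indicator_of_notMem hy]
    by_cases hyc : y ∈ closure ω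
    · have hyV := hωV hyc
      have hpy : p y = 0 := hfr y (by rw [hω.frontier_eq]; exact ⟨hyc, hy⟩)
      have hpd := (hp.contDiffAt (hV.mem_nhds hyV)).differentiableAt one_ne_zero
      have hpO : p =O[𝓝 y] fun z => ‖z - y‖ := by
        simpa [hpy] using hpd.isBigO_sub.norm_right
      have hwO : w =O[𝓝 y] fun _ => (1 : ℝ) :=
        (hw.contDiffAt (hV.mem_nhds hyV)).continuousAt.isBigO_one ℝ
      have h1 : (ω.indicator fun z => flatten ε (p z) * w z) =O[𝓝 y] fun z => p z ^ 2 * w z := by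
        refine Asymptotics.IsBigO.of_bound (1 / ε) ?_
        filter_upwards [hV.mem_nhds hyV] with z hz
        by_cases hzω : z ∈ ω
        · have hpz := hp0 z hz
          have hpos : 0 < p z + ε := add_pos_of_nonneg_of_pos hpz hε
          rw [indicator_of_mem hzω, flatten_eq hpos.ne', norm_mul, norm_mul, ← mul_assoc, norm_div,
            Real.norm_of_nonneg hpos.le, div_eq_inv_mul, one_div]
          gcongr
          linarith
        · rw [indicator_of_notMem hzω, norm_zero]
          positivity
      refine Asymptotics.IsBigO.hasFDerivAt (n := 2) (h1.trans ?_) one_lt_two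
      simpa using (hpO.pow 2).mul hwO
    · refine (hasFDerivAt_const (0 : ℝ) y).congr_of_eventuallyEq ?_
      filter_upwards [isClosed_closure.isOpen_compl.mem_nhds hyc] with z hz
      exact indicator_of_notMem (fun h => hz (subset_closure h)) _

variable [FiniteDimensional ℝ E] [MeasurableSpace E] [BorelSpace E]

/-- Integration by parts over a bounded open set, without any regularity of its boundary, for a
nonnegative function that vanishes on the boundary. -/
theorem setIntegral_fderiv_mul_eq_zero (μ : Measure E) [μ.IsAddHaarMeasure]
    {ω V : Set E} (hω : IsOpen ω) (hb : Bornology.IsBounded ω) (hV : IsOpen V)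
    (hωV : closure ω ⊆ V) {p w : E → ℝ} (hp : ContDiffOn ℝ 1 p V) (hw : ContDiffOn ℝ 1 w V)
    (hp0 : ∀ y ∈ V, 0 ≤ p y) (hfr : ∀ y ∈ frontier ω, p y = 0) (e : E) :
    IntegrableOn (fun y => p y * fderiv ℝ w y e + w y * fderiv ℝ p y e) ω μ ∧
    ∫ y in ω, (p y * fderiv ℝ w y e + w y * fderiv ℝ p y e) ∂μ = 0 := by
  have : ProperSpace E := FiniteDimensional.proper ℝ E
  have hK : IsCompact (closure ω) := hb.isCompact_closure
  have hintOn : ∀ k : E → ℝ, ContinuousOn k V → IntegrableOn k ω μ := fun k hk =>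
    ((hk.mono hωV).integrableOn_compact hK).mono_set subset_closure
  have hpc := hp.continuousOn
  have hwc := hw.continuousOn
  have hdp : ContinuousOn (fun y => fderiv ℝ p y e) V :=
    (hp.continuousOn_fderiv_of_isOpen hV le_rfl).clm_apply continuousOn_const
  have hdw : ContinuousOn (fun y => fderiv ℝ w y e) V :=
    (hw.continuousOn_fderiv_of_isOpen hV le_rfl).clm_apply continuousOn_const
  have hpos : ∀ ε > 0, ∀ y ∈ V, 0 < p y + ε := fun ε hε y hy =>
    add_pos_of_nonneg_of_pos (hp0 y hy) hε
  have hfl : ∀ ε > 0, ContinuousOn (fun y => flatten ε (p y)) V := fun ε hε =>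
    (hpc.sub continuousOn_const).add
      (continuousOn_const.div (hpc.add continuousOn_const) fun y hy => (hpos ε hε y hy).ne')
  have hfl' : ∀ ε > 0, ContinuousOn (fun y => 1 - ε ^ 2 / (p y + ε) ^ 2) V := fun ε hε =>
    continuousOn_const.sub (continuousOn_const.div ((hpc.add continuousOn_const).pow 2)
      fun y hy => pow_ne_zero 2 (hpos ε hε y hy).ne')
  set G : ℝ → E → ℝ := fun ε y => flatten ε (p y) * fderiv ℝ w y e
        + w y * ((1 - ε ^ 2 / (p y + ε) ^ 2) * fderiv ℝ p y e)
  have hG : ∀ ε > 0, ContinuousOn (G ε) V := fun ε hε =>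
    ((hfl ε hε).mul hdw).add (hwc.mul ((hfl' ε hε).mul hdp))
  -- `G ε` is the derivative of the extension by zero, and integration by parts on the whole space
  -- against the constant 1 shows that its integral vanishes.
  have hzero : ∀ ε > 0, ∫ y in ω, G ε y ∂μ = 0 := by
    intro ε hε
    set F : E → ℝ := ω.indicator fun y => flatten ε (p y) * w y
    have hF := hasFDerivAt_flatten_mul_indicator hω hV hωV hp hw hp0 hfr hε
    have hFe : (fun y => fderiv ℝ F y e) = ω.indicator (G ε) := by
      funext y
      rw [(hF y).fderiv]
      by_cases hy : y ∈ ω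
      · simp [hy, G]
      · simp [hy]
    have hFi : Integrable F μ :=
      (integrable_indicator_iff hω.measurableSet).mpr (hintOn _ ((hfl ε hε).mul hwc))
    have hFi' : Integrable (fun y => fderiv ℝ F y e) μ := by
      rw [hFe]
      exact (integrable_indicator_iff hω.measurableSet).mpr (hintOn _ (hG ε hε))
    have := integral_mul_fderiv_eq_neg_fderiv_mul_of_integrable (μ := μ) (f := F)
      (g := fun _ => (1 : ℝ)) (v := e) (by simpa using hFi') (by simp) (by simpa using hFi)
      (fun y _ => (hF y).differentiableAt) (fun y _ => differentiableAt_const _)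
    simp only [fderiv_fun_const, Pi.zero_apply, _root_.zero_apply, mul_zero,
      integral_zero, mul_one] at this
    rw [hFe, integral_indicator hω.measurableSet] at this
    linarith
  have hbound : IntegrableOn (fun y => |p y * fderiv ℝ w y e| + |w y * fderiv ℝ p y e|) ω μ :=
    hintOn _ ((hpc.mul hdw).abs.add (hwc.mul hdp).abs)
  refine ⟨hintOn _ ((hpc.mul hdw).add (hwc.mul hdp)), ?_⟩
  have hlim : Tendsto (fun ε => ∫ y in ω, G ε y ∂μ) (𝓝[>] 0)
      (𝓝 (∫ y in ω, (p y * fderiv ℝ w y e + w y * fderiv ℝ p y e) ∂μ)) := by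
    refine tendsto_integral_filter_of_dominated_convergence _ ?_ ?_ hbound ?_
    · filter_upwards [self_mem_nhdsWithin] with ε hε
      exact (hintOn _ (hG ε hε)).aestronglyMeasurable
    · filter_upwards [self_mem_nhdsWithin] with ε hε
      refine (ae_restrict_iff' hω.measurableSet).mpr (Eventually.of_forall fun y hy => ?_)
      have hyV := hωV (subset_closure hy)
      have h1 := hpos ε hε y hyV
      have h2 := hp0 y hyV
      have hε0 : 0 < ε := hε
      have h3 : |flatten ε (p y)| ≤ |p y| := by
        rw [flatten_eq h1.ne', abs_of_nonneg h2, abs_of_nonneg (by positivity),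
          div_le_iff₀ h1]
        nlinarith
      have h4 : |1 - ε ^ 2 / (p y + ε) ^ 2| ≤ 1 := by
        have h5 : ε ^ 2 / (p y + ε) ^ 2 ≤ 1 := by
          rw [div_le_one (by positivity)]
          gcongr
          linarith
        have h6 : 0 ≤ ε ^ 2 / (p y + ε) ^ 2 := by positivity
        exact abs_le.mpr ⟨by linarith, by linarith⟩
      refine (norm_add_le _ _).trans (add_le_add ?_ ?_)
      · rw [Real.norm_eq_abs, abs_mul, abs_mul]
        gcongr
      · rw [Real.norm_eq_abs, abs_mul, abs_mul, abs_mul]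
        gcongr
        exact mul_le_of_le_one_left (abs_nonneg _) h4
    · refine (ae_restrict_iff' hω.measurableSet).mpr (Eventually.of_forall fun y hy => ?_)
      have hyV := hωV (subset_closure hy)
      -- At a zero of `p` the factor `1 - ε ^ 2 / (p y + ε) ^ 2` is 0 and does not tend to 1. The
      -- limit is still correct, because `p ≥ 0` has a minimum there and its derivative vanishes.
      rcases (hp0 y hyV).eq_or_lt with h0 | h0
      · have hmin : IsLocalMin p y := by
          filter_upwards [hV.mem_nhds hyV] with z hz
          rw [← h0]
          exact hp0 z hz
        have hd : fderiv ℝ p y = 0 := hmin.fderiv_eq_zero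
        refine tendsto_const_nhds.congr' ?_
        filter_upwards [self_mem_nhdsWithin] with ε hε
        have hε0 : ε ≠ 0 := ne_of_gt hε
        have : flatten ε 0 = 0 := by rw [flatten_eq (by simpa using hε0)]; simp
        simp [G, hd, ← h0, this]
      · have hc : ContinuousAt (fun ε => G ε y) 0 := by
          have : (p y + 0) ≠ 0 := by simpa using h0.ne'
          have h' : (p y + 0) ^ 2 ≠ 0 := pow_ne_zero 2 this
          simp only [G, flatten]
          fun_prop (disch := assumption)
        have h1 := hc.tendsto.mono_left (nhdsWithin_le_nhds (s := Ioi 0))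
        simpa [G, flatten] using h1
  have hlim0 : Tendsto (fun ε => ∫ y in ω, G ε y ∂μ) (𝓝[>] 0) (𝓝 0) := by
    refine tendsto_const_nhds.congr' ?_
    filter_upwards [self_mem_nhdsWithin] with ε hε using (hzero ε hε).symm
  exact tendsto_nhds_unique hlim hlim0

end DivergenceTheorem

theorem plane_eq_sum_single (x : E2) :
    x = x 0 • EuclideanSpace.single 0 (1 : ℝ) + x 1 • EuclideanSpace.single 1 (1 : ℝ) := by
  ext i; fin_cases i <;> simp

theorem fderiv_apply_coord {X ι : Type*} [NormedAddCommGroup X] [NormedSpace ℝ X] [Fintype ι]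
    {W : X → EuclideanSpace ℝ ι} {y : X} (hW : DifferentiableAt ℝ W y) (i : ι) (x : X) :
    fderiv ℝ (fun y => W y i) y x = fderiv ℝ W y x i := by
  have h : HasFDerivAt (fun y => W y i)
      ((EuclideanSpace.proj i : EuclideanSpace ℝ ι →L[ℝ] ℝ).comp (fderiv ℝ W y)) y :=
    (EuclideanSpace.proj i : EuclideanSpace ℝ ι →L[ℝ] ℝ).hasFDerivAt.comp y hW.hasFDerivAt
  rw [h.fderiv]
  rfl

theorem setIntegral_fderiv_add_mul_planeDiv {ω V : Set E2} (hω : IsOpen ω)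
    (hb : Bornology.IsBounded ω) (hV : IsOpen V) (hωV : closure ω ⊆ V) {p : E2 → ℝ} {W : E2 → E2}
    (hp : ContDiffOn ℝ 1 p V) (hW : ContDiffOn ℝ 1 W V) (hp0 : ∀ y ∈ V, 0 ≤ p y)
    (hfr : ∀ y ∈ frontier ω, p y = 0) :
    ∫ y in ω, (fderiv ℝ p y (W y) + p y * planeDiv W y) = 0 := by
  have hWi : ∀ i, ContDiffOn ℝ 1 (fun y => W y i) V := fun i =>
    (EuclideanSpace.proj i : E2 →L[ℝ] ℝ).contDiff.comp_contDiffOn hW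
  obtain ⟨i0, h0⟩ := setIntegral_fderiv_mul_eq_zero volume hω hb hV hωV hp (hWi 0) hp0 hfr
    (EuclideanSpace.single 0 1)
  obtain ⟨i1, h1⟩ := setIntegral_fderiv_mul_eq_zero volume hω hb hV hωV hp (hWi 1) hp0 hfr
    (EuclideanSpace.single 1 1)
  have hsum := integral_add i0 i1
  rw [h0, h1, add_zero] at hsum
  rw [← hsum]
  refine setIntegral_congr_fun hω.measurableSet fun y hy => ?_
  have hyV := hωV (subset_closure hy)
  have hWd := (hW.contDiffAt (hV.mem_nhds hyV)).differentiableAt one_ne_zero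
  simp only [fderiv_apply_coord hWd, planeDiv, planeTrace]
  nth_rewrite 1 [plane_eq_sum_single (W y)]
  simp only [map_add, map_smul, smul_eq_mul]
  ring

/-! ### The planar gas system and its basic balance laws -/

section Planar

/-- Classical solutions of the planar equations which hold at a fixed height: `m` is the friction
coefficient at this height. The momentum equation is tested with a constant vector `e`. -/
structure IsPlanarSolution (γ l m : ℝ) (D : Set (ℝ × E2)) (R P : ℝ × E2 → ℝ)
    (u : ℝ × E2 → E2) : Prop where
  isOpen : IsOpen D
  contDiffOn_density : ContDiffOn ℝ 1 R D
  contDiffOn_pressure : ContDiffOn ℝ 1 P D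
  contDiffOn_velocity : ContDiffOn ℝ 1 u D
  pressure_nonneg : ∀ q ∈ D, 0 ≤ P q
  continuity : ∀ t y, (t, y) ∈ D →
    fderiv ℝ R (t, y) (1, u (t, y)) + R (t, y) * planeDiv (fun y => u (t, y)) y = 0
  pressure : ∀ t y, (t, y) ∈ D →
    fderiv ℝ P (t, y) (1, u (t, y)) + γ * P (t, y) * planeDiv (fun y => u (t, y)) y = 0
  momentum : ∀ t y, (t, y) ∈ D → ∀ e : E2,
    R (t, y) * (fderiv ℝ u (t, y) (1, u (t, y)) 0 * e 0 + fderiv ℝ u (t, y) (1, u (t, y)) 1 * e 1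
        + l * (u (t, y) 0 * e 1 - u (t, y) 1 * e 0)
        + m * (u (t, y) 0 * e 0 + u (t, y) 1 * e 1))
      = -fderiv ℝ (fun y => P (t, y)) y e

/-- The sets `ω t`, `t ∈ I`, are open and consist of the same particles at all times. -/
structure IsPlanarMaterial (I : Set ℝ) (u : ℝ × E2 → E2) (ω : ℝ → Set E2) : Prop where
  isOpen : ∀ s ∈ I, IsOpen (ω s)
  exists_trajectory : ∀ s ∈ I, ∀ y ∈ ω s, ∃ c : ℝ → E2,
    c s = y ∧ ∀ t ∈ I, c t ∈ ω t ∧ HasDerivAt c (u (t, c t)) t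

/-- The vector `X₂ = (x₂, -x₁)`. -/
def rotated (y : E2) : E2 := !₂[y 1, -y 0]

theorem contDiff_rotated : ContDiff ℝ 1 rotated := by
  rw [contDiff_euclidean]
  intro i
  fin_cases i
  · exact (EuclideanSpace.proj (1 : Fin 2) : E2 →L[ℝ] ℝ).contDiff
  · exact (EuclideanSpace.proj (0 : Fin 2) : E2 →L[ℝ] ℝ).contDiff.neg

theorem planeDiv_rotated (y : E2) : planeDiv rotated y = 0 := by
  have hd : DifferentiableAt ℝ rotated y := contDiff_rotated.differentiable one_ne_zero y
  have h0 : HasFDerivAt (fun y => rotated y 0) (EuclideanSpace.proj (1 : Fin 2) : E2 →L[ℝ] ℝ) y :=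
    (EuclideanSpace.proj (1 : Fin 2) : E2 →L[ℝ] ℝ).hasFDerivAt
  have h1 : HasFDerivAt (fun y => rotated y 1)
      (-(EuclideanSpace.proj (0 : Fin 2) : E2 →L[ℝ] ℝ)) y :=
    (EuclideanSpace.proj (0 : Fin 2) : E2 →L[ℝ] ℝ).hasFDerivAt.neg
  simp only [planeDiv, planeTrace]
  rw [← fderiv_apply_coord hd, ← fderiv_apply_coord hd, h0.fderiv, h1.fderiv]
  simp

theorem planeDiv_id (y : E2) : planeDiv (fun y => y) y = 2 := by
  simp [planeDiv, planeTrace]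
  norm_num

variable {γ l m : ℝ} {D : Set (ℝ × E2)} {R P : ℝ × E2 → ℝ} {u : ℝ × E2 → E2}
  {I : Set ℝ} {ω : ℝ → Set E2} {t₀ : ℝ}

/-- Mass is carried by the particles: the continuity equation cancels the divergence term of
Reynolds transport, and only the derivative of `a` along particles remains. -/
theorem IsPlanarSolution.hasDerivAt_setIntegral_density_mul (h : IsPlanarSolution γ l m D R P u)
    (hI : IsOpen I) (hω : IsPlanarMaterial I u ω) (ht₀ : t₀ ∈ I)
    (hbdd : Bornology.IsBounded (ω t₀)) (hclos : ∀ y ∈ closure (ω t₀), (t₀, y) ∈ D)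
    {a : ℝ × E2 → ℝ} (ha : ContDiffOn ℝ 1 a D) :
    HasDerivAt (fun s => ∫ y in ω s, R (s, y) * a (s, y))
      (∫ y in ω t₀, R (t₀, y) * fderiv ℝ a (t₀, y) (1, u (t₀, y))) t₀ := by
  have := hasDerivAt_setIntegral_of_trajectories h.isOpen h.contDiffOn_velocity
    (h.contDiffOn_density.mul ha) hI hω.isOpen hω.exists_trajectory ht₀ hbdd hclos
  refine this.congr_deriv (setIntegral_congr_fun (hω.isOpen _ ht₀).measurableSet fun y hy => ?_)
  have hD := h.isOpen.mem_nhds (hclos y (subset_closure hy))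
  have h1 := ((h.contDiffOn_density.contDiffAt hD).differentiableAt one_ne_zero)
  have h2 := ((ha.contDiffAt hD).differentiableAt one_ne_zero)
  have h3 := h.continuity t₀ y (hclos y (subset_closure hy))
  simp only [fderiv_fun_mul h1 h2, _root_.add_apply, _root_.smul_apply,
    smul_eq_mul]
  linear_combination a (t₀, y) * h3

theorem hasFDerivAt_coord {X ι : Type*} [NormedAddCommGroup X] [NormedSpace ℝ X] [Fintype ι]
    {W : X → EuclideanSpace ℝ ι} {W' : X →L[ℝ] EuclideanSpace ℝ ι} {x : X}
    (h : HasFDerivAt W W' x) (i : ι) :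
    HasFDerivAt (fun y => W y i) ((EuclideanSpace.proj i : EuclideanSpace ℝ ι →L[ℝ] ℝ).comp W') x :=
  (EuclideanSpace.proj i : EuclideanSpace ℝ ι →L[ℝ] ℝ).hasFDerivAt.comp x h

theorem contDiffOn_dot {W W' : ℝ × E2 → E2} (h : ContDiffOn ℝ 1 W D) (h' : ContDiffOn ℝ 1 W' D) :
    ContDiffOn ℝ 1 (fun q => W q 0 * W' q 0 + W q 1 * W' q 1) D := by
  rw [contDiffOn_euclidean] at h h'
  exact ((h 0).mul (h' 0)).add ((h 1).mul (h' 1))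

theorem fderiv_dot {W W' : ℝ × E2 → E2} {q : ℝ × E2} (h : DifferentiableAt ℝ W q)
    (h' : DifferentiableAt ℝ W' q) (x : ℝ × E2) :
    fderiv ℝ (fun q => W q 0 * W' q 0 + W q 1 * W' q 1) q x
      = fderiv ℝ W q x 0 * W' q 0 + fderiv ℝ W q x 1 * W' q 1
        + (W q 0 * fderiv ℝ W' q x 0 + W q 1 * fderiv ℝ W' q x 1) := by
  have e := ((hasFDerivAt_coord h.hasFDerivAt 0).mul (hasFDerivAt_coord h'.hasFDerivAt 0)).add
    ((hasFDerivAt_coord h.hasFDerivAt 1).mul (hasFDerivAt_coord h'.hasFDerivAt 1))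
  rw [HasFDerivAt.fderiv (f := fun q => W q 0 * W' q 0 + W q 1 * W' q 1) e]
  simp
  ring

/-- The rate of change of `∫ (u, W) ρ` for a `C¹` vector field `W`. -/
theorem IsPlanarSolution.hasDerivAt_setIntegral_dot (h : IsPlanarSolution γ l m D R P u)
    (hI : IsOpen I) (hω : IsPlanarMaterial I u ω) (ht₀ : t₀ ∈ I)
    (hbdd : Bornology.IsBounded (ω t₀)) (hclos : ∀ y ∈ closure (ω t₀), (t₀, y) ∈ D)
    (hfr : ∀ y ∈ frontier (ω t₀), P (t₀, y) = 0)
    {W : ℝ × E2 → E2} (hW : ContDiffOn ℝ 1 W D) :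
    HasDerivAt (fun s => ∫ y in ω s, R (s, y) * (u (s, y) 0 * W (s, y) 0 + u (s, y) 1 * W (s, y) 1))
      (∫ y in ω t₀, (P (t₀, y) * planeDiv (fun y => W (t₀, y)) y
        + R (t₀, y) * (u (t₀, y) 0 * fderiv ℝ W (t₀, y) (1, u (t₀, y)) 0
            + u (t₀, y) 1 * fderiv ℝ W (t₀, y) (1, u (t₀, y)) 1
          - l * (u (t₀, y) 0 * W (t₀, y) 1 - u (t₀, y) 1 * W (t₀, y) 0)
          - m * (u (t₀, y) 0 * W (t₀, y) 0 + u (t₀, y) 1 * W (t₀, y) 1)))) t₀ := by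
  refine (h.hasDerivAt_setIntegral_density_mul hI hω ht₀ hbdd hclos
    (contDiffOn_dot h.contDiffOn_velocity hW)).congr_deriv ?_
  set V : Set E2 := {y | (t₀, y) ∈ D}
  have hslice : ContDiff ℝ 1 (fun y : E2 => (t₀, y)) := contDiff_const.prodMk contDiff_id
  have hV : IsOpen V := h.isOpen.preimage hslice.continuous
  have hmaps : MapsTo (fun y : E2 => (t₀, y)) V D := fun y hy => hy
  have hPV := h.contDiffOn_pressure.comp hslice.contDiffOn hmaps
  have hWV := hW.comp hslice.contDiffOn hmaps
  have hdiv := setIntegral_fderiv_add_mul_planeDiv (hω.isOpen t₀ ht₀) hbdd hV hclos hPV hWV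
    (fun y hy => h.pressure_nonneg _ hy) hfr
  have hPW : IntegrableOn (fun y => fderiv ℝ (fun y => P (t₀, y)) y (W (t₀, y))
      + P (t₀, y) * planeDiv (fun y => W (t₀, y)) y) (ω t₀) := by
    have hW' := hWV.continuousOn_fderiv_of_isOpen hV le_rfl
    have hWc : ∀ i : Fin 2, ContinuousOn (fun y =>
        fderiv ℝ (fun y => W (t₀, y)) y (EuclideanSpace.single i 1) i) V := fun i =>
      (EuclideanSpace.proj i : E2 →L[ℝ] ℝ).continuous.comp_continuousOn
        (hW'.clm_apply continuousOn_const)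
    have hc := ((hPV.continuousOn_fderiv_of_isOpen hV le_rfl).clm_apply hWV.continuousOn).add
      (hPV.continuousOn.mul ((hWc 0).add (hWc 1)))
    exact ((hc.mono hclos).integrableOn_compact hbdd.isCompact_closure).mono_set subset_closure
  have hRa : IntegrableOn (fun y => R (t₀, y) *
      fderiv ℝ (fun q => u q 0 * W q 0 + u q 1 * W q 1) (t₀, y) (1, u (t₀, y))) (ω t₀) := by
    have hs := hslice.continuous.continuousOn (s := V)
    have hc := (h.contDiffOn_density.continuousOn.comp hs hmaps).mul
      ((((contDiffOn_dot h.contDiffOn_velocity hW).continuousOn_fderiv_of_isOpen h.isOpen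
        le_rfl).comp hs hmaps).clm_apply ((continuousOn_const (c := (1 : ℝ))).prodMk
          (h.contDiffOn_velocity.continuousOn.comp hs hmaps)))
    exact ((hc.mono hclos).integrableOn_compact hbdd.isCompact_closure).mono_set subset_closure
  -- Adding ∫ div (P W) = 0 trades the pressure gradient of the momentum equation for `P` times the
  -- divergence of `W`.
  have hadd := integral_add hRa hPW
  have hdiv' : ∫ y in ω t₀, (fderiv ℝ (fun y => P (t₀, y)) y (W (t₀, y))
      + P (t₀, y) * planeDiv (fun y => W (t₀, y)) y) = 0 := hdiv
  rw [hdiv', add_zero] at hadd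
  rw [← hadd]
  refine setIntegral_congr_fun (hω.isOpen _ ht₀).measurableSet fun y hy => ?_
  have hyD := hclos y (subset_closure hy)
  have hD := h.isOpen.mem_nhds hyD
  have h1 := (h.contDiffOn_velocity.contDiffAt hD).differentiableAt one_ne_zero
  have h2 := (hW.contDiffAt hD).differentiableAt one_ne_zero
  have h3 := h.momentum t₀ y hyD (W (t₀, y))
  simp only [fderiv_dot h1 h2]
  linear_combination h3

end Planar

/-! ### Horizontal planes in space and derivatives along them -/

section Slice

/-- The inclusion of the plane into the space. -/
def planeIncl : E2 →L[ℝ] E3 := LinearMap.toContinuousLinearMap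
  { toFun := fun y => !₂[y 0, y 1, 0]
    map_add' := fun x y => by ext i; fin_cases i <;> simp
    map_smul' := fun c y => by ext i; fin_cases i <;> simp }

/-- The projection of the space onto the plane. -/
def planeProj : E3 →L[ℝ] E2 := LinearMap.toContinuousLinearMap
  { toFun := fun x => !₂[x 0, x 1]
    map_add' := fun x y => by ext i; fin_cases i <;> simp
    map_smul' := fun c y => by ext i; fin_cases i <;> simp }

theorem planeIncl_apply (y : E2) : planeIncl y = !₂[y 0, y 1, 0] := rfl

theorem planeProj_apply (x : E3) : planeProj x = !₂[x 0, x 1] := rfl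

theorem planeIncl_planeProj {x : E3} (hx : x 2 = 0) : planeIncl (planeProj x) = x := by
  ext i; fin_cases i <;> simp [planeIncl_apply, planeProj_apply, hx]

theorem atHeight_planeProj {x : E3} {z : ℝ} (hx : x 2 = z) : atHeight z (planeProj x) = x := by
  ext i; fin_cases i <;> simp [atHeight, planeProj_apply, hx]

theorem planeProj_atHeight (z : ℝ) (y : E2) : planeProj (atHeight z y) = y := by
  ext i; fin_cases i <;> simp [atHeight, planeProj_apply]

theorem atHeight_eq (z : ℝ) : atHeight z = fun y => planeIncl y + z • e3 := by
  funext y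
  ext i; fin_cases i <;> simp [atHeight, planeIncl_apply, e3]

theorem hasFDerivAt_atHeight (z : ℝ) (y : E2) : HasFDerivAt (atHeight z) planeIncl y := by
  rw [atHeight_eq]
  exact planeIncl.hasFDerivAt.add_const (z • e3)

theorem contDiff_atHeight (z : ℝ) : ContDiff ℝ 1 (atHeight z) := by
  rw [atHeight_eq]
  exact planeIncl.contDiff.add contDiff_const

/-- Space-time points at the height `z`. -/
def slice (z : ℝ) (q : ℝ × E2) : ℝ × E3 := (q.1, atHeight z q.2)

theorem contDiff_slice (z : ℝ) : ContDiff ℝ 1 (slice z) :=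
  contDiff_fst.prodMk ((contDiff_atHeight z).comp contDiff_snd)

variable {F : Type*} [NormedAddCommGroup F] [NormedSpace ℝ F]

theorem fderiv_comp_slice {f : ℝ × E3 → F} {z : ℝ} {q : ℝ × E2}
    (hf : DifferentiableAt ℝ f (slice z q)) (x : ℝ × E2) :
    fderiv ℝ (fun q => f (slice z q)) q x = fderiv ℝ f (slice z q) (x.1, planeIncl x.2) := by
  have h : HasFDerivAt (slice z) ((ContinuousLinearMap.fst ℝ ℝ E2).prod
      (planeIncl.comp (ContinuousLinearMap.snd ℝ ℝ E2))) q :=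
    hasFDerivAt_fst.prodMk ((hasFDerivAt_atHeight z q.2).comp q hasFDerivAt_snd)
  rw [HasFDerivAt.fderiv (f := fun q => f (slice z q)) (hf.hasFDerivAt.comp q h)]
  rfl

theorem deriv_time_eq {E : Type*} [NormedAddCommGroup E] [NormedSpace ℝ E] {f : ℝ × E → F}
    {t : ℝ} {x : E} (hf : DifferentiableAt ℝ f (t, x)) :
    deriv (fun s => f (s, x)) t = fderiv ℝ f (t, x) (1, 0) :=
  (hf.hasFDerivAt.comp_hasDerivAt t ((hasDerivAt_id t).prodMk (hasDerivAt_const t x))).deriv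

theorem hasFDerivAt_space {E : Type*} [NormedAddCommGroup E] [NormedSpace ℝ E] {f : ℝ × E → F}
    {t : ℝ} {x : E} (hf : DifferentiableAt ℝ f (t, x)) :
    HasFDerivAt (fun x => f (t, x)) ((fderiv ℝ f (t, x)).comp (ContinuousLinearMap.inr ℝ ℝ E)) x :=
  hf.hasFDerivAt.comp x (hasFDerivAt_prodMk_right t x)

theorem fderiv_space_eq {E : Type*} [NormedAddCommGroup E] [NormedSpace ℝ E] {f : ℝ × E → F}
    {t : ℝ} {x : E} (hf : DifferentiableAt ℝ f (t, x)) (e : E) :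
    fderiv ℝ (fun x => f (t, x)) x e = fderiv ℝ f (t, x) (0, e) := by
  rw [(hasFDerivAt_space hf).fderiv]
  rfl

end Slice

/-! ### Reduction of the spatial problem to a fixed height -/

section Reduction

variable {γ l g : ℝ} {μ : ℝ → ℝ} {D : Set (ℝ × E3)} {ρ p : ℝ → E3 → ℝ} {U : ℝ → E3 → E3}

/-- The horizontal velocity at the height `z`. -/
def planeVelocity (U : ℝ → E3 → E3) (z : ℝ) (q : ℝ × E2) : E2 :=
  planeProj (U q.1 (atHeight z q.2))

/-- The restriction of a scalar field to the height `z`. -/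
def planeScalar (ρ : ℝ → E3 → ℝ) (z : ℝ) (q : ℝ × E2) : ℝ := ρ q.1 (atHeight z q.2)

theorem gradient_apply_eq (f : E3 → ℝ) (x : E3) (i : Fin 3) :
    gradient f x i = fderiv ℝ f x (EuclideanSpace.single i 1) := by
  rw [← inner_gradient_left, EuclideanSpace.inner_single_right]
  simp

theorem divergence_smul {f : E3 → ℝ} {V : E3 → E3} {x : E3} (hf : DifferentiableAt ℝ f x)
    (hV : DifferentiableAt ℝ V x) :
    divergence (fun y => f y • V y) x = f x * divergence V x + fderiv ℝ f x (V x) := by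
  have hx : V x = ∑ i, V x i • EuclideanSpace.single i (1 : ℝ) := by
    ext j; fin_cases j <;> simp [Fin.sum_univ_three]
  conv_rhs => rw [hx]
  simp only [divergence, fderiv_fun_smul hf hV, Fin.sum_univ_three, map_add, map_smul]
  simp
  ring

theorem IsClassicalSolution.isPlanarSolution (h : IsClassicalSolution γ l g μ D ρ p U)
    (hU₃ : ∀ t x, (t, x) ∈ D → U t x 2 = 0) (z : ℝ) :
    IsPlanarSolution γ l (μ z) (slice z ⁻¹' D) (planeScalar ρ z) (planeScalar p z)
      (planeVelocity U z) := by
  have hs := contDiff_slice z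
  have hmaps : MapsTo (slice z) (slice z ⁻¹' D) D := fun q hq => hq
  have hdρ : ∀ q ∈ D, DifferentiableAt ℝ (fun q : ℝ × E3 => ρ q.1 q.2) q := fun q hq =>
    (h.contDiffOn_density.contDiffAt (h.isOpen.mem_nhds hq)).differentiableAt one_ne_zero
  have hdp : ∀ q ∈ D, DifferentiableAt ℝ (fun q : ℝ × E3 => p q.1 q.2) q := fun q hq =>
    (h.contDiffOn_pressure.contDiffAt (h.isOpen.mem_nhds hq)).differentiableAt one_ne_zero
  have hdU : ∀ q ∈ D, DifferentiableAt ℝ (fun q : ℝ × E3 => U q.1 q.2) q := fun q hq =>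
    (h.contDiffOn_velocity.contDiffAt (h.isOpen.mem_nhds hq)).differentiableAt one_ne_zero
  have hu1 : ContDiffOn ℝ 1 (planeVelocity U z) (slice z ⁻¹' D) :=
    planeProj.contDiff.comp_contDiffOn (h.contDiffOn_velocity.comp hs.contDiffOn hmaps)
  have hopen : IsOpen (slice z ⁻¹' D) := h.isOpen.preimage hs.continuous
  have hU2 : ∀ t x, (t, x) ∈ D → planeIncl (planeProj (U t x)) = U t x := fun t x hx =>
    planeIncl_planeProj (hU₃ t x hx)
  -- `U₃` vanishes on an open set, so all its derivatives do; in particular ∂₃U₃ = 0, and the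
  -- spatial divergence equals the planar one.
  have hU2' : ∀ q ∈ D, ∀ e, fderiv ℝ (fun q : ℝ × E3 => U q.1 q.2) q e 2 = 0 := by
    intro q hq e
    rw [← fderiv_apply_coord (hdU q hq)]
    have : (fun q : ℝ × E3 => U q.1 q.2 2) =ᶠ[𝓝 q] fun _ => (0 : ℝ) := by
      filter_upwards [h.isOpen.mem_nhds hq] with q' hq' using hU₃ _ _ hq'
    rw [this.fderiv_eq]
    simp
  have hdu : ∀ t y, (t, atHeight z y) ∈ D → ∀ e, fderiv ℝ (planeVelocity U z) (t, y) e
      = planeProj (fderiv ℝ (fun q : ℝ × E3 => U q.1 q.2) (t, atHeight z y)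
        (e.1, planeIncl e.2)) := by
    intro t y hy e
    have h0 := fderiv_comp_slice (f := fun q : ℝ × E3 => U q.1 q.2) (q := (t, y)) (hdU _ hy) e
    change _ = fderiv ℝ (fun q : ℝ × E3 => U q.1 q.2) (t, atHeight z y) _ at h0
    rw [← h0]
    have h1 : DifferentiableAt ℝ (fun q => (fun q : ℝ × E3 => U q.1 q.2) (slice z q)) (t, y) :=
      DifferentiableAt.comp (t, y) (g := fun q : ℝ × E3 => U q.1 q.2) (hdU _ hy)
        (hs.differentiable one_ne_zero _)
    have := planeProj.hasFDerivAt.comp (t, y) h1.hasFDerivAt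
    rw [HasFDerivAt.fderiv (f := planeVelocity U z) this]
    rfl
  have hsplit : ∀ v : E3, ((1 : ℝ), v) = (1, 0) + (0, v) := fun v => by simp
  have hdiv : ∀ t y, (t, atHeight z y) ∈ D →
      planeDiv (fun y => planeVelocity U z (t, y)) y = divergence (U t) (atHeight z y) := by
    intro t y hy
    have h1 : ∀ i : Fin 2, fderiv ℝ (fun y => planeVelocity U z (t, y)) y
        (EuclideanSpace.single i 1) = planeProj (fderiv ℝ (fun q : ℝ × E3 => U q.1 q.2)
          (t, atHeight z y) (0, planeIncl (EuclideanSpace.single i 1))) := fun i => by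
      rw [fderiv_space_eq ((hu1.contDiffAt (hopen.mem_nhds hy)).differentiableAt one_ne_zero),
        hdu t y hy]
    have h2 : ∀ e : E3, fderiv ℝ (U t) (atHeight z y) e
        = fderiv ℝ (fun q : ℝ × E3 => U q.1 q.2) (t, atHeight z y) (0, e) := fun e =>
      fderiv_space_eq (f := fun q : ℝ × E3 => U q.1 q.2) (hdU _ hy) e
    have i0 : planeIncl (EuclideanSpace.single 0 1) = EuclideanSpace.single 0 1 := by
      ext i; fin_cases i <;> simp [planeIncl_apply]
    have i1 : planeIncl (EuclideanSpace.single 1 1) = EuclideanSpace.single 1 1 := by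
      ext i; fin_cases i <;> simp [planeIncl_apply]
    simp only [planeDiv, planeTrace, divergence, Fin.sum_univ_three, h1, h2, hU2' _ hy, i0, i1,
      planeProj_apply]
    simp
  refine ⟨hopen, h.contDiffOn_density.comp hs.contDiffOn hmaps,
    h.contDiffOn_pressure.comp hs.contDiffOn hmaps, hu1,
    fun q hq => h.pressure_nonneg _ _ hq, fun t y hy => ?_, fun t y hy => ?_, fun t y hy e => ?_⟩
  · have hy' : (t, atHeight z y) ∈ D := hy
    have h1 := h.continuity t _ hy'
    have h2 := fderiv_comp_slice (f := fun q : ℝ × E3 => ρ q.1 q.2) (z := z) (q := (t, y))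
      (hdρ _ hy') (1, planeVelocity U z (t, y))
    have h3 := hasFDerivAt_space (f := fun q : ℝ × E3 => ρ q.1 q.2) (hdρ _ hy')
    have h4 := hasFDerivAt_space (f := fun q : ℝ × E3 => U q.1 q.2) (hdU _ hy')
    rw [deriv_time_eq (f := fun q : ℝ × E3 => ρ q.1 q.2) (hdρ _ hy'),
      divergence_smul h3.differentiableAt h4.differentiableAt,
      fderiv_space_eq (f := fun q : ℝ × E3 => ρ q.1 q.2) (hdρ _ hy')] at h1
    have h5 : planeIncl (planeVelocity U z (t, y)) = U t (atHeight z y) := hU2 _ _ hy'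
    change fderiv ℝ (planeScalar ρ z) (t, y) _ = _ at h2
    rw [h2, hdiv t y hy', h5]
    change fderiv ℝ (fun q : ℝ × E3 => ρ q.1 q.2) (t, atHeight z y) (1, U t (atHeight z y)) + _ = 0
    rw [hsplit, map_add]
    simp only [planeScalar]
    linarith
  · have hy' : (t, atHeight z y) ∈ D := hy
    have h1 := h.pressure t _ hy'
    have h2 := fderiv_comp_slice (f := fun q : ℝ × E3 => p q.1 q.2) (z := z) (q := (t, y))
      (hdp _ hy') (1, planeVelocity U z (t, y))
    rw [deriv_time_eq (f := fun q : ℝ × E3 => p q.1 q.2) (hdp _ hy'), inner_gradient_right,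
      fderiv_space_eq (f := fun q : ℝ × E3 => p q.1 q.2) (hdp _ hy')] at h1
    have h5 : planeIncl (planeVelocity U z (t, y)) = U t (atHeight z y) := hU2 _ _ hy'
    change fderiv ℝ (planeScalar p z) (t, y) _ = _ at h2
    rw [h2, hdiv t y hy', h5]
    change fderiv ℝ (fun q : ℝ × E3 => p q.1 q.2) (t, atHeight z y) (1, U t (atHeight z y)) + _ = 0
    rw [hsplit, map_add]
    simpa [planeScalar] using h1
  · have hy' : (t, atHeight z y) ∈ D := hy
    have h1 := h.momentum t _ hy'
    rw [deriv_time_eq (f := fun q : ℝ × E3 => U q.1 q.2) (hdU _ hy'),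
      fderiv_space_eq (f := fun q : ℝ × E3 => U q.1 q.2) (hdU _ hy'), ← map_add, ← hsplit] at h1
    have h5 : planeIncl (planeVelocity U z (t, y)) = U t (atHeight z y) := hU2 _ _ hy'
    have h6 : fderiv ℝ (planeVelocity U z) (t, y) (1, planeVelocity U z (t, y))
        = planeProj (fderiv ℝ (fun q : ℝ × E3 => U q.1 q.2) (t, atHeight z y)
          (1, U t (atHeight z y))) := by rw [hdu t y hy', h5]
    have h7 := fderiv_comp_slice (f := fun q : ℝ × E3 => p q.1 q.2) (z := z) (q := (t, y))
      (hdp _ hy') (0, e)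
    have h8 : fderiv ℝ (fun y => planeScalar p z (t, y)) y e
        = gradient (p t) (atHeight z y) 0 * e 0 + gradient (p t) (atHeight z y) 1 * e 1 := by
      have hP : DifferentiableAt ℝ (planeScalar p z) (t, y) :=
        ((h.contDiffOn_pressure.comp hs.contDiffOn hmaps).contDiffAt
          (hopen.mem_nhds hy)).differentiableAt one_ne_zero
      rw [fderiv_space_eq hP]
      change fderiv ℝ (planeScalar p z) (t, y) _ = _ at h7
      rw [h7, gradient_apply_eq, gradient_apply_eq,
        fderiv_space_eq (f := fun q : ℝ × E3 => p q.1 q.2) (hdp _ hy'),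
        fderiv_space_eq (f := fun q : ℝ × E3 => p q.1 q.2) (hdp _ hy'),
        mul_comm _ (e 0), mul_comm _ (e 1), ← smul_eq_mul, ← smul_eq_mul, ← map_smul, ← map_smul,
        ← map_add]
      congr 1
      ext i
      · simp
      · fin_cases i <;> simp [planeIncl_apply]
    rw [h8, h6]
    -- Gravity acts only on the third component, so the horizontal components of the momentum
    -- equation form the planar one.
    have c0 := congrArg (fun v : E3 => v 0) h1
    have c1 := congrArg (fun v : E3 => v 1) h1
    simp [cross, horizontal, e3, atHeight, crossProduct] at c0 c1
    simp only [planeScalar, planeVelocity, planeProj_apply]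
    simp [atHeight]
    linear_combination e 0 * c0 + e 1 * c1

/-- The height of a particle has zero derivative on the interval `I`, hence is constant, so a
trajectory that starts in the section stays in it and projects to a planar trajectory. -/
theorem IsMaterialVolume.isPlanarMaterial {I : Set ℝ} {Ω : ℝ → Set E3}
    (hΩ : IsMaterialVolume I U Ω) (hU₃ : ∀ t x, (t, x) ∈ D → U t x 2 = 0)
    (hΩD : ∀ t ∈ I, ∀ x ∈ Ω t, (t, x) ∈ D) (hI : I.OrdConnected) (z : ℝ) :
    IsPlanarMaterial I (planeVelocity U z) (fun s => hsection (Ω s) z) := by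
  refine ⟨fun s hs => (hΩ.isOpen s hs).preimage (contDiff_atHeight z).continuous,
    fun s hs y hy => ?_⟩
  obtain ⟨c, hcs, hc⟩ := hΩ.exists_trajectory s hs (atHeight z y) hy
  have hz : ∀ t ∈ I, c t 2 = z := by
    intro t ht
    have hd : ∀ t ∈ I, HasDerivWithinAt (fun t => c t 2) 0 I t := fun t ht => by
      have h1 := (EuclideanSpace.proj 2 : E3 →L[ℝ] ℝ).hasFDerivAt.comp_hasDerivAt t (hc t ht).2
      have h2 : (EuclideanSpace.proj 2 : E3 →L[ℝ] ℝ) (U t (c t)) = 0 :=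
        hU₃ t _ (hΩD t ht _ (hc t ht).1)
      rw [h2] at h1
      exact h1.hasDerivWithinAt
    have h3 := hI.convex.norm_image_sub_le_of_norm_hasDerivWithin_le (C := 0) hd (by simp) hs ht
    rw [zero_mul] at h3
    have h4 : c t 2 = c s 2 := sub_eq_zero.mp (norm_le_zero_iff.mp h3)
    rw [h4, hcs]
    simp [atHeight]
  refine ⟨fun t => planeProj (c t), by simp [hcs, planeProj_atHeight], fun t ht => ?_⟩
  have hct : atHeight z (planeProj (c t)) = c t := atHeight_planeProj (hz t ht)
  refine ⟨?_, ?_⟩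
  · change atHeight z (planeProj (c t)) ∈ Ω t
    rw [hct]
    exact (hc t ht).1
  · have := planeProj.hasFDerivAt.comp_hasDerivAt t (hc t ht).2
    simp only [planeVelocity, hct]
    exact this

end Reduction

/-! ### Rates of change of the planar functionals -/

section Planar

variable {γ l m : ℝ} {D : Set (ℝ × E2)} {R P : ℝ × E2 → ℝ} {u : ℝ × E2 → E2}
  {I : Set ℝ} {ω : ℝ → Set E2} {t₀ : ℝ}

theorem integrableOn_slice (hbdd : Bornology.IsBounded (ω t₀)) (hclos : ∀ y ∈ closure (ω t₀), (t₀, y) ∈ D)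
    {k : ℝ × E2 → ℝ} (hk : ContinuousOn k D) : IntegrableOn (fun y => k (t₀, y)) (ω t₀) := by
  have hs : Continuous (fun y : E2 => (t₀, y)) := by fun_prop
  exact ((hk.comp hs.continuousOn hclos).integrableOn_compact hbdd.isCompact_closure).mono_set
    subset_closure

theorem contDiffOn_rotated_snd : ContDiffOn ℝ 1 (fun q : ℝ × E2 => rotated q.2) D :=
  (contDiff_rotated.comp contDiff_snd).contDiffOn

theorem fderiv_rotated_snd (q x : ℝ × E2) :
    fderiv ℝ (fun q : ℝ × E2 => rotated q.2) q x = rotated x.2 := by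
  have hd : DifferentiableAt ℝ (fun q : ℝ × E2 => rotated q.2) q :=
    (contDiff_rotated.comp contDiff_snd).differentiable one_ne_zero q
  have hsnd : HasFDerivAt (fun q : ℝ × E2 => q.2) (ContinuousLinearMap.snd ℝ ℝ E2) q :=
    hasFDerivAt_snd
  have h0 := hasFDerivAt_coord hsnd 1
  have h1 := (hasFDerivAt_coord hsnd 0).neg
  ext i
  rw [← fderiv_apply_coord hd]
  fin_cases i
  · exact congrArg (fun A : ℝ × E2 →L[ℝ] ℝ => A x) h0.fderiv
  · exact congrArg (fun A : ℝ × E2 →L[ℝ] ℝ => A x) h1.fderiv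

theorem fderiv_snd_apply (q x : ℝ × E2) :
    fderiv ℝ (fun q : ℝ × E2 => q.2) q x = x.2 := by
  rw [fderiv_snd]
  rfl

theorem IsPlanarSolution.hasDerivAt_inertia (h : IsPlanarSolution γ l m D R P u)
    (hI : IsOpen I) (hω : IsPlanarMaterial I u ω) (ht₀ : t₀ ∈ I)
    (hbdd : Bornology.IsBounded (ω t₀)) (hclos : ∀ y ∈ closure (ω t₀), (t₀, y) ∈ D) :
    HasDerivAt (fun s => ∫ y in ω s, R (s, y) * (y 0 * y 0 + y 1 * y 1))
      (2 * ∫ y in ω t₀, R (t₀, y) * (u (t₀, y) 0 * y 0 + u (t₀, y) 1 * y 1)) t₀ := by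
  have hsnd : ContDiffOn ℝ 1 (fun q : ℝ × E2 => q.2) D := contDiff_snd.contDiffOn
  refine (h.hasDerivAt_setIntegral_density_mul hI hω ht₀ hbdd hclos
    (contDiffOn_dot hsnd hsnd)).congr_deriv ?_
  rw [← integral_const_mul]
  refine setIntegral_congr_fun (hω.isOpen _ ht₀).measurableSet fun y hy => ?_
  have hd : DifferentiableAt ℝ (fun q : ℝ × E2 => q.2) (t₀, y) := differentiableAt_snd
  simp only [fderiv_dot hd hd, fderiv_snd_apply]
  ring

/-- The field W = X₂ is divergence free, so pressure exerts no torque, and its derivative along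
particles is the rotated velocity, orthogonal to `u`. The Coriolis force paired with X₂ gives l (u,
X₁). -/
theorem IsPlanarSolution.hasDerivAt_angularMomentum (h : IsPlanarSolution γ l m D R P u)
    (hI : IsOpen I) (hω : IsPlanarMaterial I u ω) (ht₀ : t₀ ∈ I)
    (hbdd : Bornology.IsBounded (ω t₀)) (hclos : ∀ y ∈ closure (ω t₀), (t₀, y) ∈ D)
    (hfr : ∀ y ∈ frontier (ω t₀), P (t₀, y) = 0) :
    HasDerivAt (fun s => ∫ y in ω s, R (s, y) * (u (s, y) 0 * y 1 + u (s, y) 1 * (-y 0)))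
      (l * (∫ y in ω t₀, R (t₀, y) * (u (t₀, y) 0 * y 0 + u (t₀, y) 1 * y 1))
        - m * ∫ y in ω t₀, R (t₀, y) * (u (t₀, y) 0 * y 1 + u (t₀, y) 1 * (-y 0))) t₀ := by
  have hsnd : ContDiffOn ℝ 1 (fun q : ℝ × E2 => q.2) D := contDiff_snd.contDiffOn
  refine (h.hasDerivAt_setIntegral_dot hI hω ht₀ hbdd hclos hfr
    (contDiffOn_rotated_snd)).congr_deriv ?_
  have i1 := integrableOn_slice hbdd hclos (h.contDiffOn_density.mul
    (contDiffOn_dot h.contDiffOn_velocity hsnd)).continuousOn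
  have i2 := integrableOn_slice hbdd hclos (h.contDiffOn_density.mul
    (contDiffOn_dot h.contDiffOn_velocity contDiffOn_rotated_snd)).continuousOn
  have e := integral_sub (i1.const_mul l) (i2.const_mul m)
  rw [integral_const_mul, integral_const_mul] at e
  refine Eq.trans (setIntegral_congr_fun (hω.isOpen _ ht₀).measurableSet fun y hy => ?_) e
  simp only [fderiv_rotated_snd, planeDiv_rotated]
  simp [rotated]
  ring

/-- The field W = X₁ has divergence 2, the source of the pressure term, and derivative `u` along
particles, the source of the kinetic term. -/
theorem IsPlanarSolution.hasDerivAt_radialMomentum (h : IsPlanarSolution γ l m D R P u)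
    (hI : IsOpen I) (hω : IsPlanarMaterial I u ω) (ht₀ : t₀ ∈ I)
    (hbdd : Bornology.IsBounded (ω t₀)) (hclos : ∀ y ∈ closure (ω t₀), (t₀, y) ∈ D)
    (hfr : ∀ y ∈ frontier (ω t₀), P (t₀, y) = 0) :
    HasDerivAt (fun s => ∫ y in ω s, R (s, y) * (u (s, y) 0 * y 0 + u (s, y) 1 * y 1))
      (2 * (∫ y in ω t₀, P (t₀, y))
        + (∫ y in ω t₀, R (t₀, y) * (u (t₀, y) 0 * u (t₀, y) 0 + u (t₀, y) 1 * u (t₀, y) 1))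
        - l * (∫ y in ω t₀, R (t₀, y) * (u (t₀, y) 0 * y 1 + u (t₀, y) 1 * (-y 0)))
        - m * ∫ y in ω t₀, R (t₀, y) * (u (t₀, y) 0 * y 0 + u (t₀, y) 1 * y 1)) t₀ := by
  have hsnd : ContDiffOn ℝ 1 (fun q : ℝ × E2 => q.2) D := contDiff_snd.contDiffOn
  refine (h.hasDerivAt_setIntegral_dot hI hω ht₀ hbdd hclos hfr hsnd).congr_deriv ?_
  have i1 := integrableOn_slice hbdd hclos (h.contDiffOn_density.mul
    (contDiffOn_dot h.contDiffOn_velocity hsnd)).continuousOn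
  have i2 := integrableOn_slice hbdd hclos (h.contDiffOn_density.mul
    (contDiffOn_dot h.contDiffOn_velocity contDiffOn_rotated_snd)).continuousOn
  have i3 := integrableOn_slice hbdd hclos (h.contDiffOn_density.mul
    (contDiffOn_dot h.contDiffOn_velocity h.contDiffOn_velocity)).continuousOn
  have i4 := integrableOn_slice hbdd hclos h.contDiffOn_pressure.continuousOn
  have e1 := integral_add (i4.const_mul 2) i3
  have e2 := integral_sub ((i4.const_mul 2).add i3) (i2.const_mul l)
  have e3 := integral_sub (((i4.const_mul 2).add i3).sub (i2.const_mul l)) (i1.const_mul m)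
  simp only [Pi.add_apply, Pi.sub_apply] at e1 e2 e3
  rw [e2, e1, integral_const_mul, integral_const_mul, integral_const_mul] at e3
  refine Eq.trans (setIntegral_congr_fun (hω.isOpen _ ht₀).measurableSet fun y hy => ?_) e3
  simp only [fderiv_snd_apply, planeDiv_id]
  simp [rotated]
  ring

/-- The rate X is computed twice: as ∫ R D|u|², and with W = u as ∫ P div u - m ∫ R |u|² + X / 2,
since (u, Du) = D|u|² / 2 and the Coriolis force does no work. The resulting equation is solved for
X. -/
theorem IsPlanarSolution.hasDerivAt_kineticEnergy (h : IsPlanarSolution γ l m D R P u)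
    (hI : IsOpen I) (hω : IsPlanarMaterial I u ω) (ht₀ : t₀ ∈ I)
    (hbdd : Bornology.IsBounded (ω t₀)) (hclos : ∀ y ∈ closure (ω t₀), (t₀, y) ∈ D)
    (hfr : ∀ y ∈ frontier (ω t₀), P (t₀, y) = 0) :
    HasDerivAt (fun s => ∫ y in ω s,
        R (s, y) * (u (s, y) 0 * u (s, y) 0 + u (s, y) 1 * u (s, y) 1))
      (2 * (∫ y in ω t₀, P (t₀, y) * planeDiv (fun y => u (t₀, y)) y)
        - 2 * m * ∫ y in ω t₀,
          R (t₀, y) * (u (t₀, y) 0 * u (t₀, y) 0 + u (t₀, y) 1 * u (t₀, y) 1)) t₀ := by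
  have hu := h.contDiffOn_velocity
  have h1 := h.hasDerivAt_setIntegral_density_mul hI hω ht₀ hbdd hclos (contDiffOn_dot hu hu)
  have h2 := h.hasDerivAt_setIntegral_dot hI hω ht₀ hbdd hclos hfr hu
  have hX := h1.unique h2
  refine h1.congr_deriv ?_
  have i1 : IntegrableOn (fun y => R (t₀, y) *
      fderiv ℝ (fun q => u q 0 * u q 0 + u q 1 * u q 1) (t₀, y) (1, u (t₀, y))) (ω t₀) :=
    integrableOn_slice hbdd hclos (k := fun q => R q *
      fderiv ℝ (fun q => u q 0 * u q 0 + u q 1 * u q 1) q (1, u q))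
      (h.contDiffOn_density.continuousOn.mul
        (((contDiffOn_dot hu hu).continuousOn_fderiv_of_isOpen h.isOpen le_rfl).clm_apply
          (continuousOn_const.prodMk hu.continuousOn)))
  have i2 := integrableOn_slice hbdd hclos (h.contDiffOn_density.mul (contDiffOn_dot hu hu)).continuousOn
  have i3 : IntegrableOn (fun y => P (t₀, y) * planeDiv (fun y => u (t₀, y)) y) (ω t₀) := by
    have hs : ContDiff ℝ 1 (fun y : E2 => (t₀, y)) := contDiff_const.prodMk contDiff_id
    have hV : IsOpen {y | (t₀, y) ∈ D} := h.isOpen.preimage hs.continuous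
    have hmaps : MapsTo (fun y : E2 => (t₀, y)) {y | (t₀, y) ∈ D} D := fun y hy => hy
    have hd := (hu.comp hs.contDiffOn hmaps).continuousOn_fderiv_of_isOpen hV le_rfl
    have hc : ∀ i : Fin 2, ContinuousOn (fun y =>
        fderiv ℝ (fun y => u (t₀, y)) y (EuclideanSpace.single i 1) i) {y | (t₀, y) ∈ D} := fun i =>
      (EuclideanSpace.proj i : E2 →L[ℝ] ℝ).continuous.comp_continuousOn
        (hd.clm_apply continuousOn_const)
    have := (h.contDiffOn_pressure.continuousOn.comp hs.continuous.continuousOn hmaps).mul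
      ((hc 0).add (hc 1))
    exact ((this.mono hclos).integrableOn_compact hbdd.isCompact_closure).mono_set subset_closure
  have e1 := integral_sub i3 (i2.const_mul m)
  have e2 := integral_add (i3.sub (i2.const_mul m)) (i1.const_mul (1 / 2))
  simp only [Pi.sub_apply] at e2
  rw [e1, integral_const_mul, integral_const_mul] at e2
  have e3 : ∫ y in ω t₀, R (t₀, y) *
      fderiv ℝ (fun q => u q 0 * u q 0 + u q 1 * u q 1) (t₀, y) (1, u (t₀, y)) = _ :=
    hX.trans (Eq.trans (setIntegral_congr_fun (hω.isOpen _ ht₀).measurableSet fun y hy => by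
      have hd := (hu.contDiffAt (h.isOpen.mem_nhds
        (hclos y (subset_closure hy)))).differentiableAt one_ne_zero
      simp only [fderiv_dot hd hd]
      ring) e2)
  linarith

theorem IsPlanarSolution.hasDerivAt_pressureIntegral (h : IsPlanarSolution γ l m D R P u)
    (hI : IsOpen I) (hω : IsPlanarMaterial I u ω) (ht₀ : t₀ ∈ I)
    (hbdd : Bornology.IsBounded (ω t₀)) (hclos : ∀ y ∈ closure (ω t₀), (t₀, y) ∈ D) :
    HasDerivAt (fun s => ∫ y in ω s, P (s, y))
      ((1 - γ) * ∫ y in ω t₀, P (t₀, y) * planeDiv (fun y => u (t₀, y)) y) t₀ := by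
  refine (hasDerivAt_setIntegral_of_trajectories h.isOpen h.contDiffOn_velocity
    h.contDiffOn_pressure hI hω.isOpen hω.exists_trajectory ht₀ hbdd hclos).congr_deriv ?_
  rw [← integral_const_mul]
  refine setIntegral_congr_fun (hω.isOpen _ ht₀).measurableSet fun y hy => ?_
  linear_combination h.pressure t₀ y (hclos y (subset_closure hy))

end Planar

section Functionals

variable (γ : ℝ) (ρ p : ℝ → E3 → ℝ) (U : ℝ → E3 → E3) (Ω : ℝ → Set E3) (t z : ℝ)

theorem functionalG_eq : functionalG ρ Ω t z = (1 / 2) * ∫ y in hsection (Ω t) z,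
    planeScalar ρ z (t, y) * (y 0 * y 0 + y 1 * y 1) := by
  simp only [functionalG, EuclideanSpace.real_norm_sq_eq, Fin.sum_univ_two, planeScalar, ← pow_two]

theorem functionalF₁_eq : functionalF₁ ρ U Ω t z = ∫ y in hsection (Ω t) z,
    planeScalar ρ z (t, y) *
      (planeVelocity U z (t, y) 0 * y 0 + planeVelocity U z (t, y) 1 * y 1) := by
  simp only [functionalF₁, radialPart, planeScalar, planeVelocity, planeProj_apply, mul_comm]
  rfl

theorem functionalF₂_eq : functionalF₂ ρ U Ω t z = ∫ y in hsection (Ω t) z,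
    planeScalar ρ z (t, y) *
      (planeVelocity U z (t, y) 0 * y 1 + planeVelocity U z (t, y) 1 * (-y 0)) := by
  unfold functionalF₂
  congr 1
  funext y
  exact mul_comm _ _

theorem kineticEnergy_eq : kineticEnergy ρ U Ω t z = (1 / 2) * ∫ y in hsection (Ω t) z,
    planeScalar ρ z (t, y) * (planeVelocity U z (t, y) 0 * planeVelocity U z (t, y) 0
      + planeVelocity U z (t, y) 1 * planeVelocity U z (t, y) 1) := by
  simp only [kineticEnergy, EuclideanSpace.real_norm_sq_eq, Fin.sum_univ_three, ← pow_two]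
  simp [planeScalar, horizontal, planeVelocity, planeProj_apply]

theorem potentialEnergy_eq : potentialEnergy γ p Ω t z = (1 / (γ - 1)) *
    ∫ y in hsection (Ω t) z, planeScalar p z (t, y) := rfl

end Functionals

end RotatingGas

end

theorem mainTheorem4 (γ l g : ℝ) (μ : ℝ → ℝ) (hγ : 1 < γ) (hl : 0 ≤ l) (hμ : ∀ z, 0 ≤ μ z)
    (D : Set (ℝ × RotatingGas.E3)) (ρ p : ℝ → RotatingGas.E3 → ℝ)
    (U : ℝ → RotatingGas.E3 → RotatingGas.E3)
    (hsol : RotatingGas.IsClassicalSolution γ l g μ D ρ p U)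
    (hU₃ : ∀ t x, (t, x) ∈ D → U t x 2 = 0)
    (I : Set ℝ) (hIopen : IsOpen I) (hIconn : I.OrdConnected)
    (Ω : ℝ → Set RotatingGas.E3) (hΩ : RotatingGas.IsMaterialVolume I U Ω)
    (hΩD : ∀ t ∈ I, ∀ x ∈ Ω t, (t, x) ∈ D)
    (z : ℝ) (hbdd : ∀ t ∈ I, Bornology.IsBounded (RotatingGas.hsection (Ω t) z))
    (hclos : ∀ t ∈ I, ∀ y ∈ closure (RotatingGas.hsection (Ω t) z),
      (t, RotatingGas.atHeight z y) ∈ D) :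
    ∀ t ∈ I,
      HasDerivAt (fun s => RotatingGas.functionalG ρ Ω s z)
        (RotatingGas.functionalF₁ ρ U Ω t z) t ∧
      ((∀ y ∈ frontier (RotatingGas.hsection (Ω t) z), p t (RotatingGas.atHeight z y) = 0) →
        HasDerivAt (fun s => RotatingGas.functionalF₂ ρ U Ω s z)
          (l * RotatingGas.functionalF₁ ρ U Ω t z - μ z * RotatingGas.functionalF₂ ρ U Ω t z) t ∧
        HasDerivAt (fun s => RotatingGas.functionalF₁ ρ U Ω s z)
          (2 * (γ - 1) * RotatingGas.potentialEnergy γ p Ω t z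
            + 2 * RotatingGas.kineticEnergy ρ U Ω t z
            - l * RotatingGas.functionalF₂ ρ U Ω t z
            - μ z * RotatingGas.functionalF₁ ρ U Ω t z) t ∧
        HasDerivAt (fun s => RotatingGas.totalEnergy γ ρ p U Ω s z)
          (-2 * μ z * RotatingGas.kineticEnergy ρ U Ω t z) t) := by
  intro t ht
  have h := hsol.isPlanarSolution hU₃ z
  have hω := hΩ.isPlanarMaterial hU₃ hΩD hIconn z
  have hγ' : γ - 1 ≠ 0 := (sub_pos.mpr hγ).ne'
  have hb := hbdd t ht
  have hc := hclos t ht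
  simp only [RotatingGas.totalEnergy, RotatingGas.functionalG_eq, RotatingGas.functionalF₁_eq,
    RotatingGas.functionalF₂_eq, RotatingGas.kineticEnergy_eq, RotatingGas.potentialEnergy_eq]
  refine ⟨?_, fun hfr => ⟨?_, ?_, ?_⟩⟩
  · exact ((h.hasDerivAt_inertia hIopen hω ht hb hc).const_mul (1 / 2)).congr_deriv (by ring)
  · exact h.hasDerivAt_angularMomentum hIopen hω ht hb hc hfr
  · refine (h.hasDerivAt_radialMomentum hIopen hω ht hb hc hfr).congr_deriv ?_
    field_simp
  -- Here ∫ p div u enters with coefficient 1 from the kinetic part and (1 - γ) / (γ - 1) = -1 from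
  -- the internal part; only friction survives.
  · refine (((h.hasDerivAt_kineticEnergy hIopen hω ht hb hc hfr).const_mul (1 / 2)).add
      ((h.hasDerivAt_pressureIntegral hIopen hω ht hb hc).const_mul (1 / (γ - 1)))).congr_deriv ?_
    field_simp
    ring
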